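/- Let $n\ge 2$ and let $M$ be a smooth $2n$-dimensional manifold with a special almost Hermitian structure (an $\mathrm{SU}(n)$-structure): a Riemannian metric $\langle\cdot,\cdot\rangle$, an orthogonal almost complex structure $I$, with Kähler form $\omega(X,Y)=\langle X,IY\rangle$, and a complex volume form $\Psi$, i.e. a smooth complex-valued $n$-form that is complex multilinear on $(TM,I)$ and satisfies $\langle\Psi,\Psi\rangle_{\mathbb C}=\frac1{n!}\sum_{i_1,\dots,i_n=1}^n|\Psi(u_{i_1},\dots,u_{i_n})|^2=1$ for unitary bases $u_1,\dots,u_n$. Let $\nabla$ be the Levi-Civita connection and $R_{X,Y}=\nabla_{[X,Y]}-[\nabla_X,\nabla_Y]$, and put, for an orthonormal basis $(e_i)$, $$\mathrm{Ric}(X,Y)=\sum_i\langle R_{X,e_i}Y,e_i\rangle,\qquad \mathrm{Ric}^*(X,Y)=\sum_i\langle R_{X,e_i}IY,Ie_i\rangle .$$ Let $\overline\nabla$ be the minimal $\mathrm{SU}(n)$-connection, i.e. the unique connection with $\overline\nabla\langle\cdot,\cdot\rangle=0$, $\overline\nabla I=0$, $\overline\nabla\Psi=0$ such that $\overline\nabla_X-\nabla_X$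 lies in the orthogonal complement $\mathfrak{su}(n)^\perp=\mathbb R\,\omega\oplus\mathfrak u(n)^\perp$ of $\mathfrak{su}(n)$ in $\mathfrak{so}(2n)$ for all $X$. Let $\hat\eta$ be the one-form such that the $\mathbb R\,\omega$-component of $\overline\nabla_X-\nabla_X$ is $Y\mapsto\hat\eta(X)\,IY$. Suppose that $M$ is Kähler, i.e. $\nabla I=0$. Then $\mathrm{Ric}^*=\mathrm{Ric}$, and: 1. if $d\hat\eta=\lambda\omega$ for some constant $\lambda\in\mathbb R\setminus\{0\}$, then $M$ is Einstein, i.e. $\mathrm{Ric}=c\,\langle\cdot,\cdot\rangle$ for a constant $c\in\mathbb R$; 2. if $\hat\eta$ is closed, then $M$ is Ricci-flat, i.e. $\mathrm{Ric}=0$. -/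

import Mathlib

open Bundle FiberBundle VectorField Module
open scoped Manifold ContDiff Topology

noncomputable section

section LeviCivita

variable {E : Type*} [NormedAddCommGroup E] [NormedSpace ℝ E] [FiniteDimensional ℝ E]
  {M : Type*} [TopologicalSpace M] [ChartedSpace E M] [IsManifold 𝓘(ℝ, E) ∞ M]

instance tangentSpace_finiteDimensional (x : M) :
    FiniteDimensional ℝ (TangentSpace 𝓘(ℝ, E) x) :=
  inferInstanceAs (FiniteDimensional ℝ E)

variable [RiemannianBundle (fun x : M ↦ TangentSpace 𝓘(ℝ, E) x)]

/-- Half of the right-hand side of the Koszul formula. -/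
def koszul (X Y Z : Π x : M, TangentSpace 𝓘(ℝ, E) x) (x : M) : ℝ :=
  (1 / 2 : ℝ) *
    (d% (fun y ↦ inner ℝ (Y y) (Z y)) x (X x)
      + d% (fun y ↦ inner ℝ (Z y) (X y)) x (Y x)
      - d% (fun y ↦ inner ℝ (X y) (Y y)) x (Z x)
      + inner ℝ (mlieBracket 𝓘(ℝ, E) X Y x) (Z x)
      - inner ℝ (mlieBracket 𝓘(ℝ, E) Y Z x) (X x)
      + inner ℝ (mlieBracket 𝓘(ℝ, E) Z X x) (Y x))

variable [IsContMDiffRiemannianBundle 𝓘(ℝ, E) ∞ E (fun x : M ↦ TangentSpace 𝓘(ℝ, E) x)]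


variable {X X' Y Y' Z Z' : Π x : M, TangentSpace 𝓘(ℝ, E) x} {x : M}

theorem mdiffAt_inner (hY : MDiffAt (T% Y) x) (hZ : MDiffAt (T% Z) x) :
    MDiffAt (fun y ↦ inner ℝ (Y y) (Z y)) x :=
  MDifferentiableAt.inner_bundle (E := fun x : M ↦ TangentSpace 𝓘(ℝ, E) x) (b := fun y ↦ y) hY hZ

theorem koszul_tensorial_right (hX : MDiffAt (T% X) x) (hY : MDiffAt (T% Y) x) :
    TensorialAt 𝓘(ℝ, E) E (fun Z ↦ koszul X Y Z x) x where
  smul {f Z} hf hZ := by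
    simp [koszul, mlieBracket_smul_left hf hZ, mlieBracket_smul_right hf hZ,
      inner_add_left, inner_smul_left, inner_smul_right,
      mvfderiv_fun_mul hf (mdiffAt_inner hY hZ), mvfderiv_fun_mul hf (mdiffAt_inner hZ hX)]
    rw [real_inner_comm (Y x) (Z x)]
    ring
  add {Z Z'} hZ hZ' := by
    simp [koszul, mlieBracket_add_left hZ hZ', mlieBracket_add_right hZ hZ',
      inner_add_left, inner_add_right,
      mvfderiv_fun_add (mdiffAt_inner hY hZ) (mdiffAt_inner hY hZ'),
      mvfderiv_fun_add (mdiffAt_inner hZ hX) (mdiffAt_inner hZ' hX)]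
    ring

theorem koszul_tensorial_left (hY : MDiffAt (T% Y) x) (hZ : MDiffAt (T% Z) x) :
    TensorialAt 𝓘(ℝ, E) E (fun X ↦ koszul X Y Z x) x where
  smul {f X} hf hX := by
    simp [koszul, mlieBracket_smul_left hf hX, mlieBracket_smul_right hf hX,
      inner_add_left, inner_smul_left, inner_smul_right,
      mvfderiv_fun_mul hf (mdiffAt_inner hX hY), mvfderiv_fun_mul hf (mdiffAt_inner hZ hX)]
    rw [real_inner_comm (Z x) (X x)]
    ring
  add {X X'} hX hX' := by
    simp [koszul, mlieBracket_add_left hX hX', mlieBracket_add_right hX hX',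
      inner_add_left, inner_add_right,
      mvfderiv_fun_add (mdiffAt_inner hX hY) (mdiffAt_inner hX' hY),
      mvfderiv_fun_add (mdiffAt_inner hZ hX) (mdiffAt_inner hZ hX')]
    ring

theorem koszul_add_mid (hX : MDiffAt (T% X) x) (hY : MDiffAt (T% Y) x) (hY' : MDiffAt (T% Y') x)
    (hZ : MDiffAt (T% Z) x) :
    koszul X (Y + Y') Z x = koszul X Y Z x + koszul X Y' Z x := by
  simp [koszul, mlieBracket_add_left hY hY', mlieBracket_add_right hY hY',
      inner_add_left, inner_add_right,
      mvfderiv_fun_add (mdiffAt_inner hY hZ) (mdiffAt_inner hY' hZ),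
      mvfderiv_fun_add (mdiffAt_inner hX hY) (mdiffAt_inner hX hY')]
  ring

theorem koszul_smul_mid {f : M → ℝ} (hf : MDiffAt f x) (hX : MDiffAt (T% X) x)
    (hY : MDiffAt (T% Y) x) (hZ : MDiffAt (T% Z) x) :
    koszul X (f • Y) Z x = f x * koszul X Y Z x + d% f x (X x) * inner ℝ (Y x) (Z x) := by
  simp [koszul, mlieBracket_smul_left hf hY, mlieBracket_smul_right hf hY,
      inner_add_left, inner_smul_left, inner_smul_right,
      mvfderiv_fun_mul hf (mdiffAt_inner hY hZ), mvfderiv_fun_mul hf (mdiffAt_inner hX hY)]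
  rw [real_inner_comm (X x) (Y x)]
  ring

/-- For a vector field `Y` differentiable at `x`, the bilinear form `(X, Z) ↦ ⟨∇_X Y, Z⟩` at `x`. -/
def koszulForm (hY : MDiffAt (T% Y) x) :
    TangentSpace 𝓘(ℝ, E) x →L[ℝ] TangentSpace 𝓘(ℝ, E) x →L[ℝ] ℝ :=
  TensorialAt.mkHom₂ (fun X Z ↦ koszul X Y Z x) x
    (fun _ hZ ↦ koszul_tensorial_left hY hZ) (fun _ hX ↦ koszul_tensorial_right hX hY)

open Classical in
/-- The Levi-Civita connection as a map on vector fields, determined by the Koszul formula;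
it takes the value `0` at points where `Y` is not differentiable. -/
def leviCivitaFun (Y : Π x : M, TangentSpace 𝓘(ℝ, E) x) (x : M) :
    TangentSpace 𝓘(ℝ, E) x →L[ℝ] TangentSpace 𝓘(ℝ, E) x :=
  if hY : MDiffAt (T% Y) x then
    ∑ i, ((koszulForm hY).flip (stdOrthonormalBasis ℝ (TangentSpace 𝓘(ℝ, E) x) i)).smulRight
      (stdOrthonormalBasis ℝ (TangentSpace 𝓘(ℝ, E) x) i)
  else 0

theorem inner_leviCivitaFun (hX : MDiffAt (T% X) x) (hY : MDiffAt (T% Y) x)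
    (hZ : MDiffAt (T% Z) x) :
    inner ℝ (leviCivitaFun Y x (X x)) (Z x) = koszul X Y Z x := by
  have h : koszulForm hY (X x) (Z x) = koszul X Y Z x :=
    TensorialAt.mkHom₂_apply (Φ := fun X Z ↦ koszul X Y Z x) _ _ hX hZ
  rw [← h, leviCivitaFun, dif_pos hY]
  conv_rhs => rw [← (stdOrthonormalBasis ℝ (TangentSpace 𝓘(ℝ, E) x)).sum_repr' (Z x)]
  simp [sum_inner, inner_smul_left, mul_comm]

theorem leviCivitaFun_isCovariantDerivativeOn :
    IsCovariantDerivativeOn E (leviCivitaFun (E := E) (M := M)) Set.univ where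
  add {Y Y' x} hY hY' _ := by
    ext v
    refine ext_inner_right ℝ fun w ↦ ?_
    have hv := mdifferentiableAt_extend 𝓘(ℝ, E) E v
    have hw := mdifferentiableAt_extend 𝓘(ℝ, E) E w
    have h := koszul_add_mid hv hY hY' hw
    rw [← inner_leviCivitaFun hv hY hw, ← inner_leviCivitaFun hv hY' hw,
      ← inner_leviCivitaFun hv (mdifferentiableAt_add_section hY hY') hw] at h
    simpa [inner_add_left] using h
  leibniz {Y f x} hY hf _ := by
    ext v
    refine ext_inner_right ℝ fun w ↦ ?_
    have hv := mdifferentiableAt_extend 𝓘(ℝ, E) E v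
    have hw := mdifferentiableAt_extend 𝓘(ℝ, E) E w
    have h := koszul_smul_mid hf hv hY hw
    rw [← inner_leviCivitaFun hv hY hw,
      ← inner_leviCivitaFun hv (hf.smul_section hY) hw] at h
    simpa [inner_add_left, inner_smul_left] using h

variable (E M) in
/-- The Levi-Civita connection of a Riemannian manifold. -/
def leviCivita : CovariantDerivative 𝓘(ℝ, E) E (fun x : M ↦ TangentSpace 𝓘(ℝ, E) x) where
  toFun := leviCivitaFun
  isCovariantDerivativeOnUniv := leviCivitaFun_isCovariantDerivativeOn

theorem leviCivita_torsion : (leviCivita E M).torsion = 0 := by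
  rw [CovariantDerivative.torsion_eq_zero_iff]
  intro X Y x hX hY
  refine ext_inner_right ℝ fun w ↦ ?_
  have hw := mdifferentiableAt_extend 𝓘(ℝ, E) E w
  have h1 := inner_leviCivitaFun hX hY hw
  have h2 := inner_leviCivitaFun hY hX hw
  simp only [extend_apply_self] at h1 h2
  rw [inner_sub_left]
  change inner ℝ (leviCivitaFun Y x (X x)) w - inner ℝ (leviCivitaFun X x (Y x)) w = _
  rw [h1, h2]
  simp only [koszul, real_inner_comm, mlieBracket_swap_apply (V := Y) (W := X),
    mlieBracket_swap_apply (V := extend E w), inner_neg_right, extend_apply_self]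
  ring

theorem leviCivita_metric (hX : MDiffAt (T% X) x) (hY : MDiffAt (T% Y) x)
    (hZ : MDiffAt (T% Z) x) :
    d% (fun y ↦ inner ℝ (Y y) (Z y)) x (X x) =
      inner ℝ (leviCivita E M Y x (X x)) (Z x) + inner ℝ (Y x) (leviCivita E M Z x (X x)) := by
  have h1 := inner_leviCivitaFun hX hY hZ
  have h2 := inner_leviCivitaFun hX hZ hY
  change _ = inner ℝ (leviCivitaFun Y x (X x)) (Z x) + inner ℝ (Y x) (leviCivitaFun Z x (X x))
  rw [real_inner_comm _ (Y x), h1, h2]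
  simp only [koszul]
  simp only [real_inner_comm, mlieBracket_swap_apply (V := Y) (W := X),
    mlieBracket_swap_apply (V := Z) (W := X), mlieBracket_swap_apply (V := Z) (W := Y), inner_neg_right]
  ring

end LeviCivita

section Curvature

/-! Tensors are evaluated on tangent vectors at `x` by means of `FiberBundle.extend E v`, a vector
field that is smooth near `x` and has the value `v` at `x`. -/

variable {E : Type*} [NormedAddCommGroup E] [NormedSpace ℝ E] [FiniteDimensional ℝ E]
  {M : Type*} [TopologicalSpace M] [ChartedSpace E M] [IsManifold 𝓘(ℝ, E) ∞ M]
  [RiemannianBundle (fun x : M ↦ TangentSpace 𝓘(ℝ, E) x)]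
  [IsContMDiffRiemannianBundle 𝓘(ℝ, E) ∞ E (fun x : M ↦ TangentSpace 𝓘(ℝ, E) x)]

/-- `R_{X,Y} Z = ∇_{[X,Y]} Z - (∇_X ∇_Y Z - ∇_Y ∇_X Z)` for vector fields. -/
def curvatureField (X Y Z : Π x : M, TangentSpace 𝓘(ℝ, E) x) (x : M) : TangentSpace 𝓘(ℝ, E) x :=
  leviCivita E M Z x (mlieBracket 𝓘(ℝ, E) X Y x)
    - (leviCivita E M (fun y ↦ leviCivita E M Z y (Y y)) x (X x)
      - leviCivita E M (fun y ↦ leviCivita E M Z y (X y)) x (Y x))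

/-- The curvature tensor `R_{u,v} w` on tangent vectors. -/
def curvature (x : M) (u v w : TangentSpace 𝓘(ℝ, E) x) : TangentSpace 𝓘(ℝ, E) x :=
  curvatureField (extend E u) (extend E v) (extend E w) x

/-- `Ric(v, w) = ∑ i, ⟨R_{v,e_i} w, e_i⟩` for an orthonormal basis `e_i`. -/
def ricci (x : M) (v w : TangentSpace 𝓘(ℝ, E) x) : ℝ :=
  ∑ i, inner ℝ (curvature x v (stdOrthonormalBasis ℝ (TangentSpace 𝓘(ℝ, E) x) i) w)
    (stdOrthonormalBasis ℝ (TangentSpace 𝓘(ℝ, E) x) i)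

variable (E M) in
/-- The metric is Einstein: `Ric` is a constant multiple of the metric. -/
def IsEinstein : Prop :=
  ∃ c : ℝ, ∀ (x : M) (v w : TangentSpace 𝓘(ℝ, E) x), ricci x v w = c * inner ℝ v w

variable (E M) in
/-- The metric is Ricci-flat. -/
def IsRicciFlat : Prop :=
  ∀ (x : M) (v w : TangentSpace 𝓘(ℝ, E) x), ricci x v w = 0

/-- The exterior derivative of a one-form,
`dθ(X, Y) = X (θ Y) - Y (θ X) - θ [X, Y]`, on tangent vectors. -/
def oneFormDeriv (θ : Π x : M, TangentSpace 𝓘(ℝ, E) x → ℝ) (x : M)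
    (v w : TangentSpace 𝓘(ℝ, E) x) : ℝ :=
  d% (fun y ↦ θ y (extend E w y)) x v - d% (fun y ↦ θ y (extend E v y)) x w
    - θ x (mlieBracket 𝓘(ℝ, E) (extend E v) (extend E w) x)

/-- The inner product `⟨A, B⟩ = ∑ i, ⟨A e_i, B e_i⟩` on endomorphisms of a tangent space. -/
def endInner {x : M} (A B : TangentSpace 𝓘(ℝ, E) x →L[ℝ] TangentSpace 𝓘(ℝ, E) x) : ℝ :=
  ∑ i, inner ℝ (A (stdOrthonormalBasis ℝ (TangentSpace 𝓘(ℝ, E) x) i))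
    (B (stdOrthonormalBasis ℝ (TangentSpace 𝓘(ℝ, E) x) i))

/-- Membership in `so(T_x M)`. -/
def IsSkew {x : M} (A : TangentSpace 𝓘(ℝ, E) x →L[ℝ] TangentSpace 𝓘(ℝ, E) x) : Prop :=
  ∀ v w, inner ℝ (A v) w = -inner ℝ v (A w)

end Curvature

section Structures

variable (E : Type*) [NormedAddCommGroup E] [NormedSpace ℝ E] [FiniteDimensional ℝ E]
  (M : Type*) [TopologicalSpace M] [ChartedSpace E M] [IsManifold 𝓘(ℝ, E) ∞ M]
  [RiemannianBundle (fun x : M ↦ TangentSpace 𝓘(ℝ, E) x)]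

/-- A smooth orthogonal almost complex structure on a Riemannian manifold. -/
structure AlmostHermitianStructure where
  /-- The almost complex structure. -/
  J : Π x : M, TangentSpace 𝓘(ℝ, E) x →L[ℝ] TangentSpace 𝓘(ℝ, E) x
  contMDiff_J : ContMDiff 𝓘(ℝ, E) (𝓘(ℝ, E).prod 𝓘(ℝ, E →L[ℝ] E)) ∞
    (fun x ↦ TotalSpace.mk' (E →L[ℝ] E)
      (E := fun x : M ↦ TangentSpace 𝓘(ℝ, E) x →L[ℝ] TangentSpace 𝓘(ℝ, E) x) x (J x))
  J_J : ∀ x v, J x (J x v) = -v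
  inner_J_J : ∀ x v w, inner ℝ (J x v) (J x w) = inner ℝ v w

namespace AlmostHermitianStructure

variable {E M} (S : AlmostHermitianStructure E M)

/-- The Kähler form `ω(v, w) = ⟨v, J w⟩`. -/
def kahlerForm (x : M) (v w : TangentSpace 𝓘(ℝ, E) x) : ℝ := inner ℝ v (S.J x w)

/-- The Hermitian scalar product `⟨v, w⟩ + i ω(v, w)`, complex linear in `v`. -/
def hermitian (x : M) (v w : TangentSpace 𝓘(ℝ, E) x) : ℂ := ⟨inner ℝ v w, S.kahlerForm x v w⟩

/-- `u` is orthonormal for the Hermitian scalar product; in real dimension `2 n` it is then a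
unitary basis of the complex vector space `(T_x M, J)`. -/
def IsUnitaryFrame {n : ℕ} (x : M) (u : Fin n → TangentSpace 𝓘(ℝ, E) x) : Prop :=
  ∀ i j, S.hermitian x (u i) (u j) = if i = j then 1 else 0

end AlmostHermitianStructure

variable {E M} in
/-- The scalar product `(1 / n!) ∑ a(u_{i_1}, …, u_{i_n}) conj (b(u_{i_1}, …, u_{i_n}))` of two
complex `n`-forms, computed in the frame `u`. -/
def formHermitian {n : ℕ} {x : M} (a b : TangentSpace 𝓘(ℝ, E) x [⋀^Fin n]→ₗ[ℝ] ℂ)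
    (u : Fin n → TangentSpace 𝓘(ℝ, E) x) : ℂ :=
  (1 / (n.factorial : ℂ)) * ∑ k : Fin n → Fin n,
    a (fun i ↦ u (k i)) * starRingEnd ℂ (b (fun i ↦ u (k i)))

/-- An `SU(n)`-structure: an almost Hermitian structure together with a smooth complex volume form
`Ψ` of unit length. -/
structure SpecialAlmostHermitianStructure (n : ℕ) extends AlmostHermitianStructure E M where
  /-- The complex volume form `Ψ = ψ₊ + i ψ₋`. -/
  Ψ : Π x : M, TangentSpace 𝓘(ℝ, E) x [⋀^Fin n]→ₗ[ℝ] ℂ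
  /-- `Ψ` is smooth: its value on smooth vector fields is a smooth function. -/
  contMDiffAt_Ψ : ∀ (x : M) (X : Fin n → Π y : M, TangentSpace 𝓘(ℝ, E) y),
    (∀ i, CMDiffAt ∞ (T% (X i)) x) →
      ContMDiffAt 𝓘(ℝ, E) 𝓘(ℝ, ℂ) ∞ (fun y ↦ Ψ y (fun i ↦ X i y)) x
  /-- `Ψ` is complex multilinear on `(T_x M, J)`. -/
  Ψ_J : ∀ x v i, Ψ x (Function.update v i (J x (v i))) = Complex.I * Ψ x v
  /-- `⟨Ψ, Ψ⟩ = 1`. -/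
  Ψ_norm : ∀ x u, toAlmostHermitianStructure.IsUnitaryFrame x u → formHermitian (Ψ x) (Ψ x) u = 1

end Structures

section IntrinsicTorsion

variable {E : Type*} [NormedAddCommGroup E] [NormedSpace ℝ E] [FiniteDimensional ℝ E]
  {M : Type*} [TopologicalSpace M] [ChartedSpace E M] [IsManifold 𝓘(ℝ, E) ∞ M]
  [RiemannianBundle (fun x : M ↦ TangentSpace 𝓘(ℝ, E) x)]
  [IsContMDiffRiemannianBundle 𝓘(ℝ, E) ∞ E (fun x : M ↦ TangentSpace 𝓘(ℝ, E) x)]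

namespace AlmostHermitianStructure

variable (S : AlmostHermitianStructure E M)

/-- `Ric*(v, w) = ∑ i, ⟨R_{v,e_i} J w, J e_i⟩` for an orthonormal basis `e_i`. -/
def starRicci (x : M) (v w : TangentSpace 𝓘(ℝ, E) x) : ℝ :=
  ∑ i, inner ℝ (curvature x v (stdOrthonormalBasis ℝ (TangentSpace 𝓘(ℝ, E) x) i) (S.J x w))
    (S.J x (stdOrthonormalBasis ℝ (TangentSpace 𝓘(ℝ, E) x) i))

/-- `(∇_v J) w = ∇_v (J W) - J (∇_v W)` for a local extension `W` of `w`. -/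
def nablaJ (x : M) (v w : TangentSpace 𝓘(ℝ, E) x) : TangentSpace 𝓘(ℝ, E) x :=
  leviCivita E M (fun y ↦ S.J y (extend E w y)) x v - S.J x (leviCivita E M (extend E w) x v)

/-- The almost Hermitian structure is Kähler: `∇ J = 0` for the Levi-Civita connection. -/
def IsKahler : Prop := ∀ (x : M) (v w : TangentSpace 𝓘(ℝ, E) x), S.nablaJ x v w = 0

end AlmostHermitianStructure

/-- The action of an endomorphism on forms,
`(A · a)(w_1, …, w_n) = -∑ i, a(w_1, …, A w_i, …, w_n)`. -/
def endAction {n : ℕ} {x : M} (A : TangentSpace 𝓘(ℝ, E) x →L[ℝ] TangentSpace 𝓘(ℝ, E) x)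
    (a : TangentSpace 𝓘(ℝ, E) x [⋀^Fin n]→ₗ[ℝ] ℂ) (w : Fin n → TangentSpace 𝓘(ℝ, E) x) : ℂ :=
  -∑ i, a (Function.update w i (A (w i)))

namespace SpecialAlmostHermitianStructure

variable {n : ℕ} (S : SpecialAlmostHermitianStructure E M n)

/-- `(∇_v Ψ)(w_1, …, w_n) = v (Ψ(W_1, …, W_n)) - ∑ i, Ψ(w_1, …, ∇_v W_i, …, w_n)` for local
extensions `W_i` of `w_i`. -/
def nablaΨ (x : M) (v : TangentSpace 𝓘(ℝ, E) x) (w : Fin n → TangentSpace 𝓘(ℝ, E) x) : ℂ :=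
  mvfderiv 𝓘(ℝ, E) (fun y ↦ S.Ψ y (fun i ↦ extend E (w i) y)) x v
    - ∑ i, S.Ψ x (Function.update w i (leviCivita E M (extend E (w i)) x v))

/-- Membership in `su(n)` at `x`, the Lie algebra of the stabiliser of the metric, `J` and `Ψ`. -/
def IsSU (x : M) (B : TangentSpace 𝓘(ℝ, E) x →L[ℝ] TangentSpace 𝓘(ℝ, E) x) : Prop :=
  IsSkew B ∧ (∀ w, B (S.J x w) = S.J x (B w)) ∧ ∀ w, endAction B (S.Ψ x) w = 0

/-- Membership in the orthogonal complement of `su(n)` in `so(T_x M)`. -/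
def IsSUPerp (x : M) (A : TangentSpace 𝓘(ℝ, E) x →L[ℝ] TangentSpace 𝓘(ℝ, E) x) : Prop :=
  IsSkew A ∧ ∀ B, S.IsSU x B → endInner A B = 0

/-- `A` is the value in the direction `v` of the intrinsic `SU(n)`-torsion, i.e. `A` lies in
`su(n)^⊥` and `∇_v + A` annihilates `J` and `Ψ` (and the metric, as `A` is skew). -/
def IsIntrinsicTorsionAt (x : M) (v : TangentSpace 𝓘(ℝ, E) x)
    (A : TangentSpace 𝓘(ℝ, E) x →L[ℝ] TangentSpace 𝓘(ℝ, E) x) : Prop :=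
  S.IsSUPerp x A ∧
  (∀ w, S.nablaJ x v w + (A (S.J x w) - S.J x (A w)) = 0) ∧
  ∀ w, S.nablaΨ x v w + endAction A (S.Ψ x) w = 0

/-- The intrinsic `SU(n)`-torsion `η + ξ`: the difference between the minimal `SU(n)`-connection
and the Levi-Civita connection. At each point and in each direction it is the unique endomorphism
satisfying `IsIntrinsicTorsionAt`. -/
def intrinsicTorsion (x : M) (v : TangentSpace 𝓘(ℝ, E) x) :
    TangentSpace 𝓘(ℝ, E) x →L[ℝ] TangentSpace 𝓘(ℝ, E) x :=
  Classical.epsilon (S.IsIntrinsicTorsionAt x v)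

/-- The one-form `η̂` with `η_v w = η̂(v) J w`, where `η` is the component of the intrinsic torsion
in `T* M ⊗ ℝ ω`, i.e. its orthogonal projection to the line spanned by `J`. -/
def etaHat (x : M) (v : TangentSpace 𝓘(ℝ, E) x) : ℝ :=
  endInner (S.intrinsicTorsion x v) (S.J x) / endInner (S.J x) (S.J x)

end SpecialAlmostHermitianStructure

end IntrinsicTorsion

end

/-!
Near each point there is a smooth local unitary frame `U` with `Ψ(U_1, …, U_n) = 1`. In it `Ψ` is
the determinant of the matrix of Hermitian products, so differentiating the determinant gives
`∇Ψ = -i θ Ψ`, where `θ = ∑ i, ⟨∇ U_i, J U_i⟩` is the connection form of the canonical bundle. On a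
Kähler manifold this is compensated by the multiple `-(1/n) θ ⊗ J` of `J`, which is orthogonal to
`su(n)`; hence `n η̂ = -θ`. Since the matrix `herm(∇ U_i, U_j)` is skew-Hermitian, its quadratic
contribution to `dθ` vanishes, and `dθ(v, w) = -∑ i, ⟨R_{v,w} U_i, J U_i⟩`. By the Bianchi identity
the latter sum is the Ricci form, which leaves `Ric(v, w) = n dη̂(v, J w)`.
-/

noncomputable section

section Calculus

section Smooth

variable {E : Type*} [NormedAddCommGroup E] [NormedSpace ℝ E]
  {M : Type*} [TopologicalSpace M] [ChartedSpace E M] [IsManifold 𝓘(ℝ, E) ∞ M] {x : M}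

theorem eventually_mdifferentiableAt {E' : Type*} [NormedAddCommGroup E'] [NormedSpace ℝ E']
    {H' : Type*} [TopologicalSpace H'] {I' : ModelWithCorners ℝ E' H'}
    {N : Type*} [TopologicalSpace N] [ChartedSpace H' N] [IsManifold I' 1 N] {f : M → N}
    (hf : ContMDiffAt 𝓘(ℝ, E) I' ∞ f x) :
    ∀ᶠ y in 𝓝 x, MDifferentiableAt 𝓘(ℝ, E) I' f y :=
  ((contMDiffAt_iff_contMDiffAt_nhds (by simp)).1 (hf.of_le (by simp) : ContMDiffAt _ _ 1 f x)).mono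
    fun _ hy ↦ hy.mdifferentiableAt one_ne_zero

theorem contMDiffAt_mvfderiv_apply {F : Type*} [NormedAddCommGroup F] [NormedSpace ℝ F]
    {f : M → F} {X : Π y : M, TangentSpace 𝓘(ℝ, E) y}
    (hf : CMDiffAt ∞ f x) (hX : CMDiffAt ∞ (T% X) x) :
    CMDiffAt ∞ (fun y ↦ d% f y (X y)) x := by
  have h : CMDiffAt ∞ (fun y ↦ (⟨f y, mfderiv% f y (X y)⟩ : TangentBundle 𝓘(ℝ, F) F)) x :=
    ContMDiffAt.clm_apply_of_inCoordinates (b₁ := id) (b₂ := f)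
      (E₁ := fun x : M ↦ TangentSpace 𝓘(ℝ, E) x) (E₂ := fun x : F ↦ TangentSpace 𝓘(ℝ, F) x)
      (hf.mfderiv_const (m := ∞) (by simp)) hX hf
  exact (contMDiff_snd_tangentBundle_modelSpace F 𝓘(ℝ, F)).contMDiffAt.comp x h

end Smooth

section Derivative

variable {E : Type*} [NormedAddCommGroup E] [NormedSpace ℝ E]
  {M : Type*} [TopologicalSpace M] [ChartedSpace E M] {x : M}
  {F : Type*} [NormedAddCommGroup F] [NormedSpace ℝ F]
  {G : Type*} [NormedAddCommGroup G] [NormedSpace ℝ G]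

theorem mvfderiv_congr_of_eventuallyEq {f g : M → F} (h : f =ᶠ[𝓝 x] g) : d% f x = d% g x := by
  simp only [mvfderiv, h.mfderiv_eq]
  rw [h.eq_of_nhds]

theorem mvfderiv_comp_fderiv {g : F → G} {f : M → F} (hg : DifferentiableAt ℝ g (f x))
    (hf : MDiffAt f x) (v : TangentSpace 𝓘(ℝ, E) x) :
    d% (fun y ↦ g (f y)) x v = fderiv ℝ g (f x) (d% f x v) := by
  have h := mfderiv_comp_apply x hg.mdifferentiableAt hf v
  rwa [mfderiv_eq_fderiv] at h

theorem mvfderiv_clm_comp (L : F →L[ℝ] G) {f : M → F} (hf : MDiffAt f x)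
    (v : TangentSpace 𝓘(ℝ, E) x) : d% (fun y ↦ L (f y)) x v = L (d% f x v) := by
  rw [mvfderiv_comp_fderiv L.differentiableAt hf, L.fderiv]

section Pi

variable {ι : Type*} [Fintype ι]

theorem mdifferentiableAt_pi_of_forall {f : M → ι → F} (hf : ∀ i, MDiffAt (fun y ↦ f y i) x) :
    MDifferentiableAt 𝓘(ℝ, E) 𝓘(ℝ, ι → F) f x :=
  mdifferentiableAt_iff .. |>.2 ⟨continuousAt_pi.2 fun i ↦ (hf i).continuousAt,
    differentiableWithinAt_pi.2 fun i ↦ (hf i).differentiableWithinAt_writtenInExtChartAt⟩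

theorem mvfderiv_pi_apply {f : M → ι → F} (hf : MDifferentiableAt 𝓘(ℝ, E) 𝓘(ℝ, ι → F) f x)
    (v : TangentSpace 𝓘(ℝ, E) x) (i : ι) :
    mvfderiv 𝓘(ℝ, E) f x v i = d% (fun y ↦ f y i) x v :=
  (mvfderiv_clm_comp (ContinuousLinearMap.proj (φ := fun _ ↦ F) i) hf v).symm

theorem mvfderiv_finsetSum_apply {f : ι → M → F} (hf : ∀ i, MDiffAt (f i) x)
    (v : TangentSpace 𝓘(ℝ, E) x) :
    d% (fun y ↦ ∑ i, f i y) x v = ∑ i, d% (f i) x v := by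
  have hpi := mdifferentiableAt_pi_of_forall (f := fun y i ↦ f i y) hf
  have h := mvfderiv_clm_comp (∑ i, ContinuousLinearMap.proj (R := ℝ) (φ := fun _ : ι ↦ F) i) hpi v
  simpa [mvfderiv_pi_apply hpi] using h

variable [DecidableEq ι]

theorem mvfderiv_det {𝕜 : Type*} [NontriviallyNormedField 𝕜] [NormedAlgebra ℝ 𝕜]
    {A : M → Matrix ι ι 𝕜}
    (hA : ∀ i j, MDifferentiableAt 𝓘(ℝ, E) 𝓘(ℝ, 𝕜) (fun y ↦ A y i j) x)
    (v : TangentSpace 𝓘(ℝ, E) x) :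
    mvfderiv 𝓘(ℝ, E) (fun y ↦ (A y).det) x v =
      ∑ i, ((A x).updateRow i fun j ↦ mvfderiv 𝓘(ℝ, E) (fun y ↦ A y i j) x v).det := by
  let det : ContinuousMultilinearMap 𝕜 (fun _ : ι ↦ ι → 𝕜) 𝕜 :=
    ⟨Matrix.detRowAlternating.toMultilinearMap, continuous_id.matrix_det⟩
  let rows : M → ι → ι → 𝕜 := fun y i ↦ (A y) i
  have hrow : ∀ i, MDifferentiableAt 𝓘(ℝ, E) 𝓘(ℝ, ι → 𝕜) (fun y ↦ rows y i) x :=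
    fun i ↦ mdifferentiableAt_pi_of_forall (hA i)
  have hrows : MDifferentiableAt 𝓘(ℝ, E) 𝓘(ℝ, ι → ι → 𝕜) rows x :=
    mdifferentiableAt_pi_of_forall hrow
  have hdet : HasFDerivAt det ((det.linearDeriv (rows x)).restrictScalars ℝ) (rows x) :=
    (det.hasFDerivAt (rows x)).restrictScalars ℝ
  have chain : mvfderiv 𝓘(ℝ, E) (fun y ↦ det (rows y)) x v =
      det.linearDeriv (rows x) (mvfderiv 𝓘(ℝ, E) rows x v) := by
    rw [mvfderiv_comp_fderiv hdet.differentiableAt hrows, hdet.fderiv]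
    rfl
  rw [ContinuousMultilinearMap.linearDeriv_apply] at chain
  refine chain.trans (Finset.sum_congr rfl fun i _ ↦
    congrArg (fun r ↦ ((A x).updateRow i r).det) ?_)
  ext j
  rw [mvfderiv_pi_apply hrows, mvfderiv_pi_apply (hrow i)]

end Pi

end Derivative

section LieBracket

variable {E : Type*} [NormedAddCommGroup E] [NormedSpace ℝ E] [CompleteSpace E]
  {M : Type*} [TopologicalSpace M] [ChartedSpace E M] [IsManifold 𝓘(ℝ, E) ∞ M]
  {X Y Z : Π x : M, TangentSpace 𝓘(ℝ, E) x} {x : M}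

theorem contMDiffAt_mlieBracket (hX : CMDiffAt ∞ (T% X) x) (hY : CMDiffAt ∞ (T% Y) x) :
    CMDiffAt ∞ (T% (mlieBracket 𝓘(ℝ, E) X Y)) x :=
  haveI : IsManifold 𝓘(ℝ, E) (((⊤ : ℕ∞) : ℕ∞ω) + 1) M := inferInstanceAs (IsManifold 𝓘(ℝ, E) ∞ M)
  haveI : IsManifold 𝓘(ℝ, E) (minSmoothness ℝ 2) M := by
    rw [minSmoothness_of_isRCLikeNormedField]; infer_instance
  ContMDiffAt.mlieBracket_vectorField (m := ⊤) (n := ⊤) hX hY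
    (by rw [minSmoothness_of_isRCLikeNormedField]; rfl)

theorem mlieBracket_leibniz (hX : CMDiffAt ∞ (T% X) x) (hY : CMDiffAt ∞ (T% Y) x)
    (hZ : CMDiffAt ∞ (T% Z) x) :
    mlieBracket 𝓘(ℝ, E) X (mlieBracket 𝓘(ℝ, E) Y Z) x =
      mlieBracket 𝓘(ℝ, E) (mlieBracket 𝓘(ℝ, E) X Y) Z x +
        mlieBracket 𝓘(ℝ, E) Y (mlieBracket 𝓘(ℝ, E) X Z) x := by
  have : IsManifold 𝓘(ℝ, E) (minSmoothness ℝ 3) M := by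
    rw [minSmoothness_of_isRCLikeNormedField]; infer_instance
  have hsmooth : minSmoothness ℝ 2 ≤ (∞ : ℕ∞ω) := by
    rw [minSmoothness_of_isRCLikeNormedField]; exact ENat.LEInfty.out
  exact leibniz_identity_mlieBracket_apply (hX.of_le hsmooth) (hY.of_le hsmooth) (hZ.of_le hsmooth)

theorem mlieBracket_mlieBracket_smul {f : M → ℝ} (hf : CMDiffAt ∞ f x)
    (hY : CMDiffAt ∞ (T% Y) x) (hZ : CMDiffAt ∞ (T% Z) x) :
    mlieBracket 𝓘(ℝ, E) X (mlieBracket 𝓘(ℝ, E) Y (f • Z)) x =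
      (d% (fun y ↦ d% f y (Y y)) x (X x) • Z x + d% f x (Y x) • mlieBracket 𝓘(ℝ, E) X Z x) +
        (d% f x (X x) • mlieBracket 𝓘(ℝ, E) Y Z x +
          f x • mlieBracket 𝓘(ℝ, E) X (mlieBracket 𝓘(ℝ, E) Y Z) x) := by
  have bracket_smul : mlieBracket 𝓘(ℝ, E) Y (f • Z) =ᶠ[𝓝 x]
      (fun y ↦ d% f y (Y y)) • Z + f • mlieBracket 𝓘(ℝ, E) Y Z := by
    filter_upwards [eventually_mdifferentiableAt hf, eventually_mdifferentiableAt hZ]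
      with y hfy hZy
    exact mlieBracket_smul_right hfy hZy
  have hfY := contMDiffAt_mvfderiv_apply hf hY
  have hYZ := contMDiffAt_mlieBracket hY hZ
  rw [Filter.EventuallyEq.rfl.mlieBracket_vectorField_eq bracket_smul,
    mlieBracket_add_right ((hfY.smul_section hZ).mdifferentiableAt (by simp))
      ((hf.smul_section hYZ).mdifferentiableAt (by simp)),
    mlieBracket_smul_right (hfY.mdifferentiableAt (by simp)) (hZ.mdifferentiableAt (by simp)),
    mlieBracket_smul_right (hf.mdifferentiableAt (by simp)) (hYZ.mdifferentiableAt (by simp))]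

theorem mvfderiv_mlieBracket {f : M → ℝ} (hf : CMDiffAt ∞ f x)
    (hX : CMDiffAt ∞ (T% X) x) (hY : CMDiffAt ∞ (T% Y) x) :
    d% f x (mlieBracket 𝓘(ℝ, E) X Y x) =
      d% (fun y ↦ d% f y (Y y)) x (X x) - d% (fun y ↦ d% f y (X y)) x (Y x) := by
  rcases subsingleton_or_nontrivial (TangentSpace 𝓘(ℝ, E) x) with hE | hE
  · simp [Subsingleton.elim (mlieBracket 𝓘(ℝ, E) X Y x) 0, Subsingleton.elim (X x) 0,
      Subsingleton.elim (Y x) 0]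
  -- Jacobi for `X`, `Y`, `f • Z` is the claim times `Z`, plus Jacobi for `X`, `Y`, `Z`.
  obtain ⟨z, hz⟩ := exists_ne (0 : TangentSpace 𝓘(ℝ, E) x)
  obtain ⟨Z, hZ, hZx⟩ : ∃ Z : Π y : M, TangentSpace 𝓘(ℝ, E) y, CMDiffAt ∞ (T% Z) x ∧ Z x = z :=
    ⟨extend E z, contMDiffAt_extend 𝓘(ℝ, E) E z, extend_apply_self ..⟩
  have jacobi := mlieBracket_leibniz hX hY (hf.smul_section hZ)
  rw [mlieBracket_mlieBracket_smul hf hY hZ, mlieBracket_mlieBracket_smul hf hX hZ,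
    mlieBracket_smul_right (hf.mdifferentiableAt (by simp)) (hZ.mdifferentiableAt (by simp)),
    mlieBracket_leibniz hX hY hZ, hZx] at jacobi
  have smul_eq : (d% f x (mlieBracket 𝓘(ℝ, E) X Y x)) • z =
      (d% (fun y ↦ d% f y (Y y)) x (X x) - d% (fun y ↦ d% f y (X y)) x (Y x)) • z := by
    simp only [smul_add] at jacobi
    rw [sub_smul, ← sub_eq_zero, ← neg_eq_zero, ← sub_eq_zero.2 jacobi]
    abel
  exact smul_left_injective ℝ hz smul_eq

end LieBracket

end Calculus

section OrthonormalFrames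

theorem exists_ne_zero_forall_inner_eq_zero {V : Type*} [NormedAddCommGroup V]
    [InnerProductSpace ℝ V] [FiniteDimensional ℝ V] {ι : Type*} [Fintype ι] (u : ι → V)
    (hι : Fintype.card ι < finrank ℝ V) : ∃ w : V, w ≠ 0 ∧ ∀ i, inner ℝ (u i) w = (0 : ℝ) := by
  have hne : (Submodule.span ℝ (Set.range u))ᗮ ≠ ⊥ := by
    rw [Ne, Submodule.orthogonal_eq_bot_iff]
    intro hspan
    have hle := finrank_range_le_card (R := ℝ) u
    rw [Set.finrank, hspan, finrank_top] at hle
    omega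
  obtain ⟨w, hw, hw0⟩ := Submodule.exists_mem_ne_zero_of_ne_bot hne
  exact ⟨w, hw0, fun i ↦ hw _ (Submodule.subset_span ⟨i, rfl⟩)⟩

variable {E : Type*} [NormedAddCommGroup E] [NormedSpace ℝ E]
  {M : Type*} [TopologicalSpace M] [ChartedSpace E M] [IsManifold 𝓘(ℝ, E) ∞ M]
  [RiemannianBundle (fun x : M ↦ TangentSpace 𝓘(ℝ, E) x)]
  [IsContMDiffRiemannianBundle 𝓘(ℝ, E) ∞ E (fun x : M ↦ TangentSpace 𝓘(ℝ, E) x)] {x : M}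

theorem contMDiffAt_inner {X Y : Π x : M, TangentSpace 𝓘(ℝ, E) x}
    (hX : CMDiffAt ∞ (T% X) x) (hY : CMDiffAt ∞ (T% Y) x) :
    CMDiffAt ∞ (fun y ↦ (inner ℝ (X y) (Y y) : ℝ)) x :=
  ContMDiffAt.inner_bundle (E := fun x : M ↦ TangentSpace 𝓘(ℝ, E) x) (b := fun y ↦ y) hX hY

theorem contMDiffAt_norm {X : Π x : M, TangentSpace 𝓘(ℝ, E) x}
    (hX : CMDiffAt ∞ (T% X) x) (hX0 : X x ≠ 0) : CMDiffAt ∞ (fun y ↦ ‖X y‖) x := by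
  have hsqrt : ContDiffAt ℝ ∞ Real.sqrt (inner ℝ (X x) (X x)) :=
    Real.contDiffAt_sqrt (real_inner_self_pos.2 hX0).ne'
  simp only [norm_eq_sqrt_real_inner]
  exact hsqrt.contMDiffAt.comp x (contMDiffAt_inner hX hX)

theorem contMDiffAt_normalize {X : Π x : M, TangentSpace 𝓘(ℝ, E) x}
    (hX : CMDiffAt ∞ (T% X) x) (hX0 : X x ≠ 0) :
    CMDiffAt ∞ (T% (fun y ↦ NormedSpace.normalize (X y))) x := by
  have hinv : ContDiffAt ℝ ∞ (fun t : ℝ ↦ t⁻¹) ‖X x‖ := contDiffAt_inv ℝ (norm_ne_zero_iff.2 hX0)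
  have hnorm := hinv.contMDiffAt.comp x (contMDiffAt_norm hX hX0)
  exact hnorm.smul_section hX

variable [FiniteDimensional ℝ E]

theorem exists_contMDiffAt_unit_orthogonal {ι : Type*} [Fintype ι]
    {e : ι → Π y : M, TangentSpace 𝓘(ℝ, E) y} (he : ∀ i, CMDiffAt ∞ (T% (e i)) x)
    (horth : ∀ᶠ y in 𝓝 x, Orthonormal ℝ fun i ↦ e i y)
    (hι : Fintype.card ι < finrank ℝ E) :
    ∃ V : Π y : M, TangentSpace 𝓘(ℝ, E) y, CMDiffAt ∞ (T% V) x ∧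
      ∀ᶠ y in 𝓝 x, ‖V y‖ = 1 ∧ ∀ i, inner ℝ (e i y) (V y) = (0 : ℝ) := by
  classical
  obtain ⟨w, hw0, hw⟩ := exists_ne_zero_forall_inner_eq_zero (fun i ↦ e i x) hι
  have hW : CMDiffAt ∞ (T% (extend E w)) x := contMDiffAt_extend 𝓘(ℝ, E) E w
  let P : Π y : M, TangentSpace 𝓘(ℝ, E) y :=
    extend E w - fun y ↦ ∑ i, (inner ℝ (e i y) (extend E w y) : ℝ) • e i y
  have hP : CMDiffAt ∞ (T% P) x :=
    hW.sub_section <| ContMDiffAt.sum_section fun i _ ↦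
      (contMDiffAt_inner (he i) hW).smul_section (he i)
  have hPx : P x ≠ 0 := by simpa [P, hw] using hw0
  refine ⟨fun y ↦ NormedSpace.normalize (P y), contMDiffAt_normalize hP hPx, ?_⟩
  have hPne := (contMDiffAt_norm hP hPx).continuousAt.eventually_ne (norm_ne_zero_iff.2 hPx)
  filter_upwards [horth, hPne] with y hy hPy
  refine ⟨NormedSpace.norm_normalize_eq_one_iff.2 (norm_ne_zero_iff.1 hPy), fun i ↦ ?_⟩
  have hPi : inner ℝ (e i y) (P y) = (0 : ℝ) := by
    simp [P, inner_sub_right, inner_sum, inner_smul_right, orthonormal_iff_ite.1 hy]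
  simp [NormedSpace.normalize, inner_smul_right, hPi]

variable (x) in
theorem exists_contMDiffAt_orthonormal (k : ℕ) (hk : k ≤ finrank ℝ E) :
    ∃ e : Fin k → Π y : M, TangentSpace 𝓘(ℝ, E) y, (∀ i, CMDiffAt ∞ (T% (e i)) x) ∧
      ∀ᶠ y in 𝓝 x, Orthonormal ℝ fun i ↦ e i y := by
  induction k with
  | zero => exact ⟨fun i ↦ i.elim0, fun i ↦ i.elim0, .of_forall fun y ↦ by simp [Orthonormal]⟩
  | succ k ih =>
    obtain ⟨e, he, horth⟩ := ih (by omega)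
    obtain ⟨V, hV, hVe⟩ := exists_contMDiffAt_unit_orthogonal he horth (by simpa using hk)
    refine ⟨Matrix.vecCons V e, Fin.cases hV he, ?_⟩
    filter_upwards [horth, hVe] with y hy ⟨hVy, hVey⟩
    have hcons : (fun i ↦ Matrix.vecCons V e i y) = Matrix.vecCons (V y) fun i ↦ e i y :=
      funext fun i ↦ by cases i using Fin.cases <;> simp
    rw [hcons, orthonormal_vecCons_iff]
    exact ⟨hVy, fun i ↦ by rw [real_inner_comm, hVey], hy⟩

theorem contMDiffAt_of_inner {V : Π x : M, TangentSpace 𝓘(ℝ, E) x}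
    (hV : ∀ W : Π x : M, TangentSpace 𝓘(ℝ, E) x, CMDiffAt ∞ (T% W) x →
      CMDiffAt ∞ (fun y ↦ (inner ℝ (W y) (V y) : ℝ)) x) : CMDiffAt ∞ (T% V) x := by
  obtain ⟨e, he, horth⟩ := exists_contMDiffAt_orthonormal x (finrank ℝ E) le_rfl
  have hsum : CMDiffAt ∞ (T% (fun y ↦ ∑ i, (inner ℝ (e i y) (V y) : ℝ) • e i y)) x :=
    ContMDiffAt.sum_section fun i _ ↦ (hV _ (he i)).smul_section (he i)
  refine hsum.congr_of_eventuallyEq ?_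
  filter_upwards [horth] with y hy
  have hspan := hy.linearIndependent.span_eq_top_of_card_eq_finrank' (Fintype.card_fin _)
  have hrepr := (OrthonormalBasis.mk hy hspan.ge).sum_repr' (V y)
  simp only [OrthonormalBasis.coe_mk] at hrepr
  rw [TotalSpace.mk_inj, hrepr]

end OrthonormalFrames

section RiemannianCurvature

variable {E : Type*} [NormedAddCommGroup E] [NormedSpace ℝ E] [FiniteDimensional ℝ E]
  {M : Type*} [TopologicalSpace M] [ChartedSpace E M] [IsManifold 𝓘(ℝ, E) ∞ M]
  [RiemannianBundle (fun x : M ↦ TangentSpace 𝓘(ℝ, E) x)]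
  [IsContMDiffRiemannianBundle 𝓘(ℝ, E) ∞ E (fun x : M ↦ TangentSpace 𝓘(ℝ, E) x)]
  {X Y Z W : Π x : M, TangentSpace 𝓘(ℝ, E) x} {x : M}

theorem leviCivita_add (hX : MDiffAt (T% X) x) (hY : MDiffAt (T% Y) x)
    (v : TangentSpace 𝓘(ℝ, E) x) :
    leviCivita E M (X + Y) x v = leviCivita E M X x v + leviCivita E M Y x v := by
  rw [(leviCivita E M).isCovariantDerivativeOnUniv.add hX hY, add_apply]

theorem leviCivita_smul {f : M → ℝ} (hf : MDiffAt f x) (hX : MDiffAt (T% X) x)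
    (v : TangentSpace 𝓘(ℝ, E) x) :
    leviCivita E M (f • X) x v = f x • leviCivita E M X x v + d% f x v • X x := by
  rw [(leviCivita E M).isCovariantDerivativeOnUniv.leibniz hX hf]
  simp

theorem leviCivita_congr (hX : MDiffAt (T% X) x) (hY : MDiffAt (T% Y) x)
    (h : ∀ᶠ y in 𝓝 x, X y = Y y) : leviCivita E M X x = leviCivita E M Y x :=
  (leviCivita E M).isCovariantDerivativeOnUniv.congr_of_eventuallyEq hX hY Filter.univ_mem h

theorem leviCivita_sub_swap (hX : MDiffAt (T% X) x) (hY : MDiffAt (T% Y) x) :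
    leviCivita E M Y x (X x) - leviCivita E M X x (Y x) = mlieBracket 𝓘(ℝ, E) X Y x :=
  (CovariantDerivative.torsion_eq_zero_iff _).1 leviCivita_torsion hX hY

theorem mvfderiv_inner (hY : MDiffAt (T% Y) x) (hZ : MDiffAt (T% Z) x)
    (v : TangentSpace 𝓘(ℝ, E) x) :
    d% (fun y ↦ inner ℝ (Y y) (Z y)) x v =
      inner ℝ (leviCivita E M Y x v) (Z x) + inner ℝ (Y x) (leviCivita E M Z x v) := by
  simpa using leviCivita_metric (mdifferentiableAt_extend 𝓘(ℝ, E) E v) hY hZ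

theorem contMDiffAt_koszul (hX : CMDiffAt ∞ (T% X) x) (hY : CMDiffAt ∞ (T% Y) x)
    (hZ : CMDiffAt ∞ (T% Z) x) : CMDiffAt ∞ (koszul X Y Z) x := by
  have deriv {A B C : Π x : M, TangentSpace 𝓘(ℝ, E) x} (hA : CMDiffAt ∞ (T% A) x)
      (hB : CMDiffAt ∞ (T% B) x) (hC : CMDiffAt ∞ (T% C) x) :
      CMDiffAt ∞ (fun y ↦ d% (fun z ↦ (inner ℝ (A z) (B z) : ℝ)) y (C y)) x :=
    contMDiffAt_mvfderiv_apply (contMDiffAt_inner hA hB) hC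
  have bracket {A B C : Π x : M, TangentSpace 𝓘(ℝ, E) x} (hA : CMDiffAt ∞ (T% A) x)
      (hB : CMDiffAt ∞ (T% B) x) (hC : CMDiffAt ∞ (T% C) x) :
      CMDiffAt ∞ (fun y ↦ (inner ℝ (mlieBracket 𝓘(ℝ, E) A B y) (C y) : ℝ)) x :=
    contMDiffAt_inner (contMDiffAt_mlieBracket hA hB) hC
  exact contMDiffAt_const.mul <| ((((((deriv hY hZ hX).add (deriv hZ hX hY)).sub
    (deriv hX hY hZ)).add (bracket hX hY hZ)).sub (bracket hY hZ hX)).add (bracket hZ hX hY))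

theorem contMDiffAt_leviCivita (hX : CMDiffAt ∞ (T% X) x) (hY : CMDiffAt ∞ (T% Y) x) :
    CMDiffAt ∞ (T% (fun y ↦ leviCivita E M Y y (X y))) x := by
  refine contMDiffAt_of_inner fun Z hZ ↦
    (contMDiffAt_koszul hX hY hZ).congr_of_eventuallyEq ?_
  filter_upwards [eventually_mdifferentiableAt hX, eventually_mdifferentiableAt hY,
    eventually_mdifferentiableAt hZ] with y hXy hYy hZy
  rw [real_inner_comm]
  exact inner_leviCivitaFun hXy hYy hZy

theorem mdiffAt_leviCivita (hX : CMDiffAt ∞ (T% X) x) (hY : CMDiffAt ∞ (T% Y) x) :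
    MDiffAt (T% (fun y ↦ leviCivita E M Y y (X y))) x :=
  (contMDiffAt_leviCivita hX hY).mdifferentiableAt (by simp)

theorem mvfderiv_mvfderiv_inner (hY : CMDiffAt ∞ (T% Y) x) (hZ : CMDiffAt ∞ (T% Z) x)
    (hW : CMDiffAt ∞ (T% W) x) (v : TangentSpace 𝓘(ℝ, E) x) :
    d% (fun y ↦ d% (fun y ↦ (inner ℝ (Z y) (W y) : ℝ)) y (Y y)) x v =
      (inner ℝ (leviCivita E M (fun y ↦ leviCivita E M Z y (Y y)) x v) (W x) +
        inner ℝ (leviCivita E M Z x (Y x)) (leviCivita E M W x v)) +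
      (inner ℝ (leviCivita E M Z x v) (leviCivita E M W x (Y x)) +
        inner ℝ (Z x) (leviCivita E M (fun y ↦ leviCivita E M W y (Y y)) x v)) := by
  have hYZ := mdiffAt_leviCivita hY hZ
  have hYW := mdiffAt_leviCivita hY hW
  have hZx := hZ.mdifferentiableAt (by simp)
  have hWx := hW.mdifferentiableAt (by simp)
  have metric : (fun y ↦ d% (fun y ↦ (inner ℝ (Z y) (W y) : ℝ)) y (Y y)) =ᶠ[𝓝 x]
      fun y ↦ inner ℝ (leviCivita E M Z y (Y y)) (W y) +
        inner ℝ (Z y) (leviCivita E M W y (Y y)) := by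
    filter_upwards [eventually_mdifferentiableAt hZ, eventually_mdifferentiableAt hW]
      with y hZy hWy
    exact mvfderiv_inner hZy hWy _
  rw [mvfderiv_congr_of_eventuallyEq metric,
    mvfderiv_fun_add (mdiffAt_inner hYZ hWx) (mdiffAt_inner hZx hYW), add_apply,
    mvfderiv_inner hYZ hWx, mvfderiv_inner hZx hYW]

theorem inner_curvatureField_skew (hX : CMDiffAt ∞ (T% X) x) (hY : CMDiffAt ∞ (T% Y) x)
    (hZ : CMDiffAt ∞ (T% Z) x) (hW : CMDiffAt ∞ (T% W) x) :
    inner ℝ (curvatureField X Y Z x) (W x) = -inner ℝ (Z x) (curvatureField X Y W x) := by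
  have commute := mvfderiv_mlieBracket (contMDiffAt_inner hZ hW) hX hY
  rw [mvfderiv_mvfderiv_inner hY hZ hW, mvfderiv_mvfderiv_inner hX hZ hW,
    mvfderiv_inner (hZ.mdifferentiableAt (by simp)) (hW.mdifferentiableAt (by simp))] at commute
  simp only [curvatureField, inner_sub_left, inner_sub_right]
  linarith

theorem curvatureField_congr_right (hX : CMDiffAt ∞ (T% X) x) (hY : CMDiffAt ∞ (T% Y) x)
    (hZ : CMDiffAt ∞ (T% Z) x) (hW : CMDiffAt ∞ (T% W) x) (hZW : Z x = W x) :
    curvatureField X Y Z x = curvatureField X Y W x := by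
  refine ext_inner_left ℝ fun v ↦ ?_
  have hv : CMDiffAt ∞ (T% (extend E v)) x := contMDiffAt_extend 𝓘(ℝ, E) E v
  have hvZ := inner_curvatureField_skew hX hY hv hZ
  have hvW := inner_curvatureField_skew hX hY hv hW
  rw [hZW] at hvZ
  simp only [extend_apply_self] at hvZ hvW
  linarith

theorem leviCivita_leviCivita_swap (hX : CMDiffAt ∞ (T% X) x) (hY : CMDiffAt ∞ (T% Y) x)
    (v : TangentSpace 𝓘(ℝ, E) x) :
    leviCivita E M (fun y ↦ leviCivita E M Y y (X y)) x v =
      leviCivita E M (fun y ↦ leviCivita E M X y (Y y)) x v +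
        leviCivita E M (mlieBracket 𝓘(ℝ, E) X Y) x v := by
  have hYX := mdiffAt_leviCivita hY hX
  have hbr := (contMDiffAt_mlieBracket hX hY).mdifferentiableAt (by simp)
  rw [← leviCivita_add hYX hbr,
    leviCivita_congr (mdiffAt_leviCivita hX hY) (mdifferentiableAt_add_section hYX hbr)]
  filter_upwards [eventually_mdifferentiableAt hX, eventually_mdifferentiableAt hY] with y hXy hYy
  rw [Pi.add_apply, ← leviCivita_sub_swap hXy hYy, add_sub_cancel]

theorem curvatureField_bianchi (hX : CMDiffAt ∞ (T% X) x) (hY : CMDiffAt ∞ (T% Y) x)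
    (hZ : CMDiffAt ∞ (T% Z) x) :
    curvatureField X Y Z x + curvatureField Y Z X x + curvatureField Z X Y x = 0 := by
  have torsion {A B C : Π x : M, TangentSpace 𝓘(ℝ, E) x} (hA : CMDiffAt ∞ (T% A) x)
      (hB : CMDiffAt ∞ (T% B) x) (hC : CMDiffAt ∞ (T% C) x) :=
    leviCivita_sub_swap ((contMDiffAt_mlieBracket hA hB).mdifferentiableAt (by simp))
      (hC.mdifferentiableAt (by simp))
  have jacobi := mlieBracket_leibniz hX hY hZ
  rw [mlieBracket_swap_apply (V := X), mlieBracket_swap_apply (V := Y), ← torsion hX hY hZ,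
    ← torsion hY hZ hX, ← torsion hX hZ hY, ← sub_eq_zero] at jacobi
  simp only [curvatureField]
  rw [leviCivita_leviCivita_swap hY hZ, leviCivita_leviCivita_swap hX hZ,
    leviCivita_leviCivita_swap hX hY, mlieBracket_swap_apply (V := Z) (W := X), map_neg,
    ← neg_eq_zero, ← jacobi]
  abel

theorem curvature_swap (u v w : TangentSpace 𝓘(ℝ, E) x) :
    curvature x u v w = -curvature x v u w := by
  simp only [curvature, curvatureField]
  rw [mlieBracket_swap_apply, map_neg]
  abel

theorem inner_curvature_skew (u v w z : TangentSpace 𝓘(ℝ, E) x) :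
    inner ℝ (curvature x u v w) z = -inner ℝ (curvature x u v z) w := by
  have skew := inner_curvatureField_skew (contMDiffAt_extend 𝓘(ℝ, E) E u)
    (contMDiffAt_extend 𝓘(ℝ, E) E v) (contMDiffAt_extend 𝓘(ℝ, E) E w)
    (contMDiffAt_extend 𝓘(ℝ, E) E z)
  rw [extend_apply_self, extend_apply_self, real_inner_comm _ w] at skew
  exact skew

theorem curvature_bianchi (u v w : TangentSpace 𝓘(ℝ, E) x) :
    curvature x u v w + curvature x v w u + curvature x w u v = 0 :=
  curvatureField_bianchi (contMDiffAt_extend 𝓘(ℝ, E) E u) (contMDiffAt_extend 𝓘(ℝ, E) E v)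
    (contMDiffAt_extend 𝓘(ℝ, E) E w)

theorem inner_curvature_pair (u v w z : TangentSpace 𝓘(ℝ, E) x) :
    inner ℝ (curvature x u v w) z = (inner ℝ (curvature x w z u) v : ℝ) := by
  have skew := inner_curvature_skew (E := E) (x := x)
  have swap (a b c d : TangentSpace 𝓘(ℝ, E) x) :
      inner ℝ (curvature x a b c) d = -(inner ℝ (curvature x b a c) d : ℝ) := by
    rw [curvature_swap, inner_neg_left]
  have bianchi (a b c d : TangentSpace 𝓘(ℝ, E) x) :
      (inner ℝ (curvature x a b c) d + inner ℝ (curvature x b c a) d +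
        inner ℝ (curvature x c a b) d : ℝ) = 0 := by
    rw [← inner_add_left, ← inner_add_left, curvature_bianchi, inner_zero_left]
  linarith [bianchi u v w z, bianchi v w z u, bianchi w z u v, bianchi z u v w,
    skew u v w z, skew v w u z, skew w u v z, skew w z u v, skew z v w u, skew v w z u,
    skew z u w v, skew u w z v, skew u v z w, skew z u v w, skew v z u w, skew v z w u,
    swap v z u w, swap u w z v, swap z u w v, swap w u v z, swap v z w u, swap u w v z]

/-- The endomorphism `z ↦ R_{v,z} w`, whose trace is `Ric(v, w)`. -/
def ricciOperator (v w : TangentSpace 𝓘(ℝ, E) x) :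
    TangentSpace 𝓘(ℝ, E) x →ₗ[ℝ] TangentSpace 𝓘(ℝ, E) x where
  toFun z := curvature x v z w
  map_add' a b := ext_inner_right ℝ fun z ↦ by
    simp only [inner_add_left, inner_curvature_pair v _ w z, inner_add_right]
  map_smul' c a := ext_inner_right ℝ fun z ↦ by
    simp only [RingHom.id_apply, real_inner_smul_left, inner_curvature_pair v _ w z,
      real_inner_smul_right]

theorem trace_ricciOperator {ι : Type*} [Fintype ι]
    (e : OrthonormalBasis ι ℝ (TangentSpace 𝓘(ℝ, E) x)) (v w : TangentSpace 𝓘(ℝ, E) x) :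
    LinearMap.trace ℝ _ (ricciOperator v w) = ∑ i, inner ℝ (curvature x v (e i) w) (e i) := by
  rw [(ricciOperator v w).trace_eq_sum_inner e]
  exact Finset.sum_congr rfl fun i _ ↦ real_inner_comm _ _

theorem ricci_eq_sum_inner_curvature {ι : Type*} [Fintype ι]
    (e : OrthonormalBasis ι ℝ (TangentSpace 𝓘(ℝ, E) x)) (v w : TangentSpace 𝓘(ℝ, E) x) :
    ricci x v w = ∑ i, inner ℝ (curvature x v (e i) w) (e i) := by
  rw [← trace_ricciOperator e, trace_ricciOperator (stdOrthonormalBasis ℝ _), ricci]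

end RiemannianCurvature

section HermitianAlgebra

variable {E : Type*} [NormedAddCommGroup E] [NormedSpace ℝ E]
  {M : Type*} [TopologicalSpace M] [ChartedSpace E M] [IsManifold 𝓘(ℝ, E) ∞ M]
  [RiemannianBundle (fun x : M ↦ TangentSpace 𝓘(ℝ, E) x)]

namespace AlmostHermitianStructure

variable (S : AlmostHermitianStructure E M) {x : M}

theorem inner_J_left (v w : TangentSpace 𝓘(ℝ, E) x) :
    inner ℝ (S.J x v) w = -inner ℝ v (S.J x w) := by
  rw [← S.inner_J_J x v (S.J x w), S.J_J, inner_neg_right, neg_neg]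

theorem inner_self_J (v : TangentSpace 𝓘(ℝ, E) x) : inner ℝ v (S.J x v) = 0 := by
  have h := S.inner_J_left v v
  rw [real_inner_comm] at h
  linarith

theorem conj_hermitian (v w : TangentSpace 𝓘(ℝ, E) x) :
    starRingEnd ℂ (S.hermitian x v w) = S.hermitian x w v :=
  Complex.ext (real_inner_comm _ _) (by
    rw [Complex.conj_im]
    exact (S.inner_J_left v w).symm.trans (real_inner_comm _ _))

theorem hermitian_add_left (v v' w : TangentSpace 𝓘(ℝ, E) x) :
    S.hermitian x (v + v') w = S.hermitian x v w + S.hermitian x v' w :=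
  Complex.ext (inner_add_left ..) (inner_add_left ..)

theorem hermitian_smul_left (r : ℝ) (v w : TangentSpace 𝓘(ℝ, E) x) :
    S.hermitian x (r • v) w = r * S.hermitian x v w :=
  Complex.ext (by simp [hermitian, real_inner_smul_left])
    (by simp [hermitian, kahlerForm, real_inner_smul_left])

theorem hermitian_sum_left {ι : Type*} (s : Finset ι) (v : ι → TangentSpace 𝓘(ℝ, E) x)
    (w : TangentSpace 𝓘(ℝ, E) x) :
    S.hermitian x (∑ i ∈ s, v i) w = ∑ i ∈ s, S.hermitian x (v i) w :=
  Complex.ext (by simp [hermitian, sum_inner]) (by simp [hermitian, kahlerForm, sum_inner])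

theorem hermitian_J_left (v w : TangentSpace 𝓘(ℝ, E) x) :
    S.hermitian x (S.J x v) w = Complex.I * S.hermitian x v w :=
  Complex.ext (by simp [hermitian, kahlerForm, S.inner_J_left])
    (by simp [hermitian, kahlerForm, S.inner_J_J])

section ComplexLinearCombination

variable {ι : Type*} [Fintype ι]

/-- The combination `∑ j, z j • u j` of tangent vectors with complex coefficients, where `i` acts
as `J`. -/
def complexLinearCombination (u : ι → TangentSpace 𝓘(ℝ, E) x) :
    (ι → ℂ) →ₗ[ℝ] TangentSpace 𝓘(ℝ, E) x where
  toFun z := ∑ j, ((z j).re • u j + (z j).im • S.J x (u j))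
  map_add' z z' := by
    simp only [Pi.add_apply, Complex.add_re, Complex.add_im, add_smul, ← Finset.sum_add_distrib]
    exact Finset.sum_congr rfl fun j _ ↦ by abel
  map_smul' r z := by simp [mul_smul, Finset.smul_sum]

theorem complexLinearCombination_apply (u : ι → TangentSpace 𝓘(ℝ, E) x) (z : ι → ℂ) :
    S.complexLinearCombination u z = ∑ j, ((z j).re • u j + (z j).im • S.J x (u j)) := rfl

theorem complexLinearCombination_single [DecidableEq ι] (u : ι → TangentSpace 𝓘(ℝ, E) x)
    (i : ι) : S.complexLinearCombination u (Pi.single i 1) = u i := by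
  rw [complexLinearCombination_apply, Finset.sum_eq_single i]
  · simp
  · intro j _ hj
    simp [hj]
  · simp

theorem complexLinearCombination_I_smul (u : ι → TangentSpace 𝓘(ℝ, E) x) (z : ι → ℂ) :
    S.complexLinearCombination u (Complex.I • z) = S.J x (S.complexLinearCombination u z) := by
  simp only [complexLinearCombination_apply, map_sum, map_add, map_smul, S.J_J]
  exact Finset.sum_congr rfl fun j _ ↦ by simp [add_comm]

theorem hermitian_complexLinearCombination_left (u : ι → TangentSpace 𝓘(ℝ, E) x) (z : ι → ℂ)
    (w : TangentSpace 𝓘(ℝ, E) x) :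
    S.hermitian x (S.complexLinearCombination u z) w = ∑ j, z j * S.hermitian x (u j) w := by
  rw [complexLinearCombination_apply, hermitian_sum_left]
  refine Finset.sum_congr rfl fun j _ ↦ ?_
  rw [hermitian_add_left, hermitian_smul_left, hermitian_smul_left, hermitian_J_left]
  nth_rw 3 [← Complex.re_add_im (z j)]
  ring

theorem map_complexLinearCombination {B : TangentSpace 𝓘(ℝ, E) x →L[ℝ] TangentSpace 𝓘(ℝ, E) x}
    (hB : ∀ w, B (S.J x w) = S.J x (B w)) (u : ι → TangentSpace 𝓘(ℝ, E) x) (z : ι → ℂ) :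
    B (S.complexLinearCombination u z) = S.complexLinearCombination (fun j ↦ B (u j)) z := by
  simp only [complexLinearCombination_apply, map_sum, map_add, map_smul, hB]

end ComplexLinearCombination

variable {S} {n : ℕ} {u : Fin n → TangentSpace 𝓘(ℝ, E) x}

theorem isUnitaryFrame_iff_orthonormal :
    S.IsUnitaryFrame x u ↔ Orthonormal ℝ (Sum.elim u fun i ↦ S.J x (u i)) := by
  have unitary_iff : S.IsUnitaryFrame x u ↔
      ∀ i j, inner ℝ (u i) (u j) = (if i = j then (1 : ℝ) else 0) ∧
        inner ℝ (u i) (S.J x (u j)) = (0 : ℝ) := by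
    refine forall₂_congr fun i j ↦ ?_
    split_ifs <;> simp [Complex.ext_iff, hermitian, kahlerForm]
  rw [unitary_iff, orthonormal_iff_ite]
  constructor
  · rintro h (i | i) (j | j) <;> simp [S.inner_J_left, S.J_J, h]
  · exact fun h i j ↦ ⟨by simpa using h (.inl i) (.inl j), by simpa using h (.inl i) (.inr j)⟩

variable [FiniteDimensional ℝ E]

/-- The real orthonormal basis `u_1, …, u_n, J u_1, …, J u_n` attached to a unitary frame. -/
def IsUnitaryFrame.orthonormalBasis (hu : S.IsUnitaryFrame x u) (hE : finrank ℝ E = 2 * n) :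
    OrthonormalBasis (Fin n ⊕ Fin n) ℝ (TangentSpace 𝓘(ℝ, E) x) :=
  have horth := isUnitaryFrame_iff_orthonormal.1 hu
  .mk horth (horth.linearIndependent.span_eq_top_of_card_eq_finrank'
    (by rw [Fintype.card_sum, Fintype.card_fin, ← two_mul]; exact hE.symm)).ge

theorem IsUnitaryFrame.coe_orthonormalBasis (hu : S.IsUnitaryFrame x u)
    (hE : finrank ℝ E = 2 * n) :
    ⇑(hu.orthonormalBasis hE) = Sum.elim u fun i ↦ S.J x (u i) := by
  rw [orthonormalBasis, OrthonormalBasis.coe_mk]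

theorem IsUnitaryFrame.complexLinearCombination_hermitian (hu : S.IsUnitaryFrame x u)
    (hE : finrank ℝ E = 2 * n) (v : TangentSpace 𝓘(ℝ, E) x) :
    S.complexLinearCombination u (fun j ↦ S.hermitian x v (u j)) = v := by
  conv_rhs => rw [← (hu.orthonormalBasis hE).sum_repr' v]
  simp only [hu.coe_orthonormalBasis, Fintype.sum_sum_type, Sum.elim_inl, Sum.elim_inr,
    ← Finset.sum_add_distrib, complexLinearCombination_apply, real_inner_comm v]
  rfl

theorem IsUnitaryFrame.hermitian_eq_sum (hu : S.IsUnitaryFrame x u) (hE : finrank ℝ E = 2 * n)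
    (v w : TangentSpace 𝓘(ℝ, E) x) :
    S.hermitian x v w = ∑ j, S.hermitian x v (u j) * S.hermitian x (u j) w := by
  rw [← hermitian_complexLinearCombination_left, hu.complexLinearCombination_hermitian hE]

end AlmostHermitianStructure

end HermitianAlgebra

section ComplexForms

theorem sum_det_updateRow_mul {ι R : Type*} [Fintype ι] [DecidableEq ι] [CommRing R]
    (A B : Matrix ι ι R) :
    ∑ i, (A.updateRow i ((A * B) i)).det = B.trace * A.det := by
  have row (i : ι) : (A.updateRow i ((A * B) i)).det = (A * B * A.adjugate) i i := by
    rw [← Matrix.cramer_transpose_apply, Matrix.cramer_eq_adjugate_mulVec,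
      ← Matrix.adjugate_transpose, Matrix.mulVec_transpose]
    rfl
  calc ∑ i, (A.updateRow i ((A * B) i)).det = (A * (B * A.adjugate)).trace := by
        simp only [row, Matrix.trace, Matrix.diag_apply, Matrix.mul_assoc]
    _ = B.trace * A.det := by
        rw [Matrix.trace_mul_comm, Matrix.mul_assoc, Matrix.adjugate_mul, Matrix.mul_smul,
          Matrix.mul_one, Matrix.trace_smul, smul_eq_mul, mul_comm]

variable {E : Type*} [NormedAddCommGroup E] [NormedSpace ℝ E]
  {M : Type*} [TopologicalSpace M] [ChartedSpace E M] {x : M} {n : ℕ}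

theorem formHermitian_self (a : TangentSpace 𝓘(ℝ, E) x [⋀^Fin n]→ₗ[ℝ] ℂ)
    (u : Fin n → TangentSpace 𝓘(ℝ, E) x) :
    formHermitian a a u = Complex.normSq (a u) := by
  have perm (σ : Equiv.Perm (Fin n)) : Complex.normSq (a fun i ↦ u (σ i)) =
      Complex.normSq (a u) := by
    have h := a.map_perm u σ
    rcases Int.units_eq_one_or (Equiv.Perm.sign σ) with hσ | hσ <;>
      simp only [hσ, one_smul, Units.neg_smul] at h <;>
      simp [← Function.comp_def, h]
  have sum_eq : ∑ k : Fin n → Fin n, Complex.normSq (a fun i ↦ u (k i)) =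
      n.factorial * Complex.normSq (a u) := by
    rw [← Finset.sum_subset (Finset.subset_univ
      (Finset.univ.map ⟨fun σ : Equiv.Perm (Fin n) ↦ (σ : Fin n → Fin n), DFunLike.coe_injective⟩))]
    · simp [perm, Fintype.card_perm]
    · intro k _ hk
      rw [a.map_eq_zero_of_not_injective _ fun hinj ↦ hk ?_, map_zero]
      have hkinj : Function.Injective k := hinj.of_comp
      exact Finset.mem_map.2 ⟨.ofBijective k (Finite.injective_iff_bijective.1 hkinj),
        Finset.mem_univ _, rfl⟩
  have hn : (n.factorial : ℂ) ≠ 0 := mod_cast n.factorial_ne_zero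
  rw [formHermitian]
  simp only [Complex.mul_conj]
  rw [← Complex.ofReal_sum, sum_eq]
  push_cast
  field_simp

variable [IsManifold 𝓘(ℝ, E) ∞ M]
  [RiemannianBundle (fun x : M ↦ TangentSpace 𝓘(ℝ, E) x)]

namespace AlmostHermitianStructure

variable {S : AlmostHermitianStructure E M} {a : TangentSpace 𝓘(ℝ, E) x [⋀^Fin n]→ₗ[ℝ] ℂ}
  {u : Fin n → TangentSpace 𝓘(ℝ, E) x}

theorem map_update_complexLinearCombination_smul
    (ha : ∀ v i, a (Function.update v i (S.J x (v i))) = Complex.I * a v)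
    (v : Fin n → TangentSpace 𝓘(ℝ, E) x) (i : Fin n) (c : ℂ) (z : Fin n → ℂ) :
    a (Function.update v i (S.complexLinearCombination u (c • z))) =
      c * a (Function.update v i (S.complexLinearCombination u z)) := by
  have hc : c • z = c.re • z + c.im • Complex.I • z := by
    ext j
    simp only [Pi.add_apply, Pi.smul_apply, smul_eq_mul, Complex.real_smul]
    nth_rw 1 [← Complex.re_add_im c]
    ring
  have hJ := ha (Function.update v i (S.complexLinearCombination u z)) i
  rw [Function.update_idem, Function.update_self] at hJ
  rw [hc, map_add, map_smul, map_smul, S.complexLinearCombination_I_smul,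
    a.map_update_add, a.map_update_smul, a.map_update_smul, hJ, Complex.real_smul,
    Complex.real_smul, ← mul_assoc, ← add_mul, Complex.re_add_im]

theorem map_complexLinearCombination_eq_det_mul
    (ha : ∀ v i, a (Function.update v i (S.J x (v i))) = Complex.I * a v)
    (A : Matrix (Fin n) (Fin n) ℂ) :
    a (fun i ↦ S.complexLinearCombination u (A i)) = A.det * a u := by
  let b : (Fin n → ℂ) [⋀^Fin n]→ₗ[ℂ] ℂ :=
    { toFun := fun z ↦ a fun i ↦ S.complexLinearCombination u (z i)
      map_update_add' := fun z i v w ↦ by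
        simp [Function.apply_update fun _ ↦ S.complexLinearCombination u]
      map_update_smul' := fun z i c v ↦ by
        rw [smul_eq_mul]
        simp only [Function.apply_update fun _ ↦ S.complexLinearCombination u]
        convert map_update_complexLinearCombination_smul ha
          (fun k ↦ S.complexLinearCombination u (z k)) i c v
      map_eq_zero_of_eq' := fun z i j hz hij ↦
        a.map_eq_zero_of_eq _ (congrArg (S.complexLinearCombination u) hz) hij }
  calc b (fun i ↦ A i) = b (Pi.basisFun ℂ (Fin n)) * (Pi.basisFun ℂ (Fin n)).det fun i ↦ A i :=
        congrArg (fun f ↦ f fun i ↦ A i) (b.eq_smul_basis_det (Pi.basisFun ℂ (Fin n)))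
    _ = b (Pi.basisFun ℂ (Fin n)) * A.det := congrArg _ (Pi.basisFun_det_apply A)
    _ = a u * A.det := by
        congr 1
        exact congrArg a (funext fun i ↦ by
          rw [Pi.basisFun_apply, S.complexLinearCombination_single])
    _ = A.det * a u := mul_comm _ _

variable [FiniteDimensional ℝ E]

theorem IsUnitaryFrame.map_eq_det_mul (hu : S.IsUnitaryFrame x u) (hE : finrank ℝ E = 2 * n)
    (ha : ∀ v i, a (Function.update v i (S.J x (v i))) = Complex.I * a v)
    (w : Fin n → TangentSpace 𝓘(ℝ, E) x) :
    a w = (Matrix.of fun i j ↦ S.hermitian x (w i) (u j)).det * a u := by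
  rw [← map_complexLinearCombination_eq_det_mul ha]
  exact congrArg a (funext fun i ↦ (hu.complexLinearCombination_hermitian hE (w i)).symm)

theorem IsUnitaryFrame.map_update_eq_det_mul (hu : S.IsUnitaryFrame x u)
    (hE : finrank ℝ E = 2 * n)
    (ha : ∀ v i, a (Function.update v i (S.J x (v i))) = Complex.I * a v)
    (w : Fin n → TangentSpace 𝓘(ℝ, E) x) (i : Fin n) (z : TangentSpace 𝓘(ℝ, E) x) :
    a (Function.update w i z) = ((Matrix.of fun i j ↦ S.hermitian x (w i) (u j)).updateRow i
      fun j ↦ S.hermitian x z (u j)).det * a u := by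
  rw [hu.map_eq_det_mul hE ha]
  congr 2
  ext k j
  rcases eq_or_ne k i with rfl | hk
  · simp
  · simp [hk]

theorem IsUnitaryFrame.endAction_eq_neg_trace_mul (hu : S.IsUnitaryFrame x u)
    (hE : finrank ℝ E = 2 * n)
    (ha : ∀ v i, a (Function.update v i (S.J x (v i))) = Complex.I * a v)
    {B : TangentSpace 𝓘(ℝ, E) x →L[ℝ] TangentSpace 𝓘(ℝ, E) x}
    (hB : ∀ w, B (S.J x w) = S.J x (B w)) (w : Fin n → TangentSpace 𝓘(ℝ, E) x) :
    endAction B a w = -(∑ j, S.hermitian x (B (u j)) (u j)) * a w := by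
  set A : Matrix (Fin n) (Fin n) ℂ := .of fun i j ↦ S.hermitian x (w i) (u j)
  set β : Matrix (Fin n) (Fin n) ℂ := .of fun i j ↦ S.hermitian x (B (u i)) (u j)
  have hrow (i : Fin n) : (fun j ↦ S.hermitian x (B (w i)) (u j)) = (A * β) i := by
    ext j
    rw [← hu.complexLinearCombination_hermitian hE (w i), S.map_complexLinearCombination hB,
      S.hermitian_complexLinearCombination_left]
    rfl
  rw [endAction, hu.map_eq_det_mul hE ha w]
  simp only [hu.map_update_eq_det_mul hE ha, hrow]
  rw [← Finset.sum_mul, sum_det_updateRow_mul, mul_assoc, neg_mul]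
  rfl

end AlmostHermitianStructure

end ComplexForms

section Kahler

variable {E : Type*} [NormedAddCommGroup E] [NormedSpace ℝ E]
  {M : Type*} [TopologicalSpace M] [ChartedSpace E M] [IsManifold 𝓘(ℝ, E) ∞ M]
  [RiemannianBundle (fun x : M ↦ TangentSpace 𝓘(ℝ, E) x)]
  {S : AlmostHermitianStructure E M} {X Z : Π x : M, TangentSpace 𝓘(ℝ, E) x} {x : M} {n : ℕ}

namespace AlmostHermitianStructure

variable (S) in
theorem contMDiffAt_J (hX : CMDiffAt ∞ (T% X) x) : CMDiffAt ∞ (T% (fun y ↦ S.J y (X y))) x :=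
  ContMDiffAt.clm_bundle_apply (b := fun y : M ↦ y) (E₁ := fun x : M ↦ TangentSpace 𝓘(ℝ, E) x)
    (E₂ := fun x : M ↦ TangentSpace 𝓘(ℝ, E) x) S.contMDiff_J.contMDiffAt hX

variable (S) in
theorem mdiffAt_J (hX : MDiffAt (T% X) x) : MDiffAt (T% (fun y ↦ S.J y (X y))) x :=
  MDifferentiableAt.clm_bundle_apply (b := fun y : M ↦ y)
    (E₁ := fun x : M ↦ TangentSpace 𝓘(ℝ, E) x) (E₂ := fun x : M ↦ TangentSpace 𝓘(ℝ, E) x)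
    (S.contMDiff_J.contMDiffAt.mdifferentiableAt (by simp)) hX

variable [FiniteDimensional ℝ E]
  [IsContMDiffRiemannianBundle 𝓘(ℝ, E) ∞ E (fun x : M ↦ TangentSpace 𝓘(ℝ, E) x)]

variable (S x) in
theorem exists_contMDiffAt_isUnitaryFrame (n : ℕ) (hn : 2 * n ≤ finrank ℝ E) :
    ∃ U : Fin n → Π y : M, TangentSpace 𝓘(ℝ, E) y, (∀ i, CMDiffAt ∞ (T% (U i)) x) ∧
      ∀ᶠ y in 𝓝 x, S.IsUnitaryFrame y fun i ↦ U i y := by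
  induction n with
  | zero => exact ⟨fun i ↦ i.elim0, fun i ↦ i.elim0, .of_forall fun y i ↦ i.elim0⟩
  | succ n ih =>
    obtain ⟨U, hU, hunitary⟩ := ih (by omega)
    obtain ⟨V, hV, hVU⟩ := exists_contMDiffAt_unit_orthogonal
      (e := Sum.elim U fun i y ↦ S.J y (U i y))
      (Sum.rec hU fun i ↦ S.contMDiffAt_J (hU i))
      (hunitary.mono fun y hy ↦ by
        convert isUnitaryFrame_iff_orthonormal.1 hy with i
        cases i <;> rfl)
      (by rw [Fintype.card_sum, Fintype.card_fin]; omega)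
    refine ⟨Matrix.vecCons V U, Fin.cases hV hU, ?_⟩
    filter_upwards [hunitary, hVU] with y hUy ⟨hVy, hVUy⟩
    have herm_V_U (i : Fin n) : S.hermitian y (U i y) (V y) = 0 :=
      Complex.ext (hVUy (.inl i)) (by
        have h := hVUy (.inr i)
        rw [Sum.elim_inr, inner_J_left, neg_eq_zero] at h
        exact h)
    have herm_V_V : S.hermitian y (V y) (V y) = 1 :=
      Complex.ext (by simp [hermitian, hVy]) (S.inner_self_J (V y))
    refine Fin.cases (Fin.cases ?_ fun j ↦ ?_) fun i ↦ Fin.cases ?_ fun j ↦ ?_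
    · simpa using herm_V_V
    · simp [← S.conj_hermitian (U j y), herm_V_U, (Fin.succ_ne_zero j).symm]
    · simpa using herm_V_U i
    · simpa using hUy i j

theorem IsKahler.leviCivita_J (hS : S.IsKahler) (hZ : MDiffAt (T% Z) x)
    (v : TangentSpace 𝓘(ℝ, E) x) :
    leviCivita E M (fun y ↦ S.J y (Z y)) x v = S.J x (leviCivita E M Z x v) := by
  have tensorial : TensorialAt 𝓘(ℝ, E) E (fun Z : Π x : M, TangentSpace 𝓘(ℝ, E) x ↦
      leviCivita E M (fun y ↦ S.J y (Z y)) x v - S.J x (leviCivita E M Z x v)) x := by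
    refine ⟨fun {f A} hf hA ↦ ?_, fun {A B} hA hB ↦ ?_⟩
    · have h : (fun y ↦ S.J y ((f • A) y)) = f • fun y ↦ S.J y (A y) := by
        ext y; simp
      rw [h, leviCivita_smul hf (S.mdiffAt_J hA), leviCivita_smul hf hA]
      simp only [map_add, map_smul, smul_sub]
      abel
    · have h : (fun y ↦ S.J y ((A + B) y)) = (fun y ↦ S.J y (A y)) + fun y ↦ S.J y (B y) := by
        ext y; simp
      rw [h, leviCivita_add (S.mdiffAt_J hA) (S.mdiffAt_J hB), leviCivita_add hA hB, map_add]
      abel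
  have h := tensorial.pointwise hZ (mdifferentiableAt_extend 𝓘(ℝ, E) E (Z x)) (by simp)
  exact sub_eq_zero.1 (h.trans (hS x v (Z x)))

theorem IsKahler.leviCivita_leviCivita_J (hS : S.IsKahler) (hX : CMDiffAt ∞ (T% X) x)
    (hZ : CMDiffAt ∞ (T% Z) x) (v : TangentSpace 𝓘(ℝ, E) x) :
    leviCivita E M (fun y ↦ leviCivita E M (fun y ↦ S.J y (Z y)) y (X y)) x v =
      S.J x (leviCivita E M (fun y ↦ leviCivita E M Z y (X y)) x v) := by
  rw [← hS.leviCivita_J (mdiffAt_leviCivita hX hZ), leviCivita_congr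
    (mdiffAt_leviCivita hX (S.contMDiffAt_J hZ)) (S.mdiffAt_J (mdiffAt_leviCivita hX hZ))]
  filter_upwards [eventually_mdifferentiableAt hZ] with y hy
  exact hS.leviCivita_J hy (X y)

theorem IsKahler.curvature_J (hS : S.IsKahler) (u v w : TangentSpace 𝓘(ℝ, E) x) :
    curvature x u v (S.J x w) = S.J x (curvature x u v w) := by
  have hext (w : TangentSpace 𝓘(ℝ, E) x) : CMDiffAt ∞ (T% (extend E w)) x :=
    contMDiffAt_extend 𝓘(ℝ, E) E w
  rw [curvature, curvatureField_congr_right (hext u) (hext v) (hext (S.J x w))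
    (S.contMDiffAt_J (hext w)) (by simp)]
  simp only [curvature, curvatureField, hS.leviCivita_leviCivita_J (hext _) (hext w),
    hS.leviCivita_J ((hext w).mdifferentiableAt (by simp)), map_sub]

theorem IsKahler.starRicci_eq_ricci (hS : S.IsKahler) (v w : TangentSpace 𝓘(ℝ, E) x) :
    S.starRicci x v w = ricci x v w := by
  simp only [starRicci, ricci, hS.curvature_J, S.inner_J_J]

theorem IsKahler.inner_curvature_J_J (hS : S.IsKahler) (u v w : TangentSpace 𝓘(ℝ, E) x) :
    inner ℝ (curvature x v (S.J x w) u) (S.J x u) =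
      inner ℝ (curvature x v u w) u + inner ℝ (curvature x v (S.J x u) w) (S.J x u) := by
  have bianchi := curvature_bianchi u (S.J x u) v
  calc inner ℝ (curvature x v (S.J x w) u) (S.J x u)
      = inner ℝ (curvature x u (S.J x u) v) (S.J x w) := inner_curvature_pair ..
    _ = -inner ℝ (curvature x v u (S.J x u)) (S.J x w)
        + inner ℝ (curvature x v (S.J x u) u) (S.J x w) := by
      rw [add_assoc, add_eq_zero_iff_eq_neg, curvature_swap (S.J x u) v] at bianchi
      rw [bianchi, neg_add, neg_neg, inner_add_left, inner_neg_left, add_comm]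
    _ = inner ℝ (curvature x v u w) u + inner ℝ (curvature x v (S.J x u) w) (S.J x u) := by
      rw [hS.curvature_J, S.inner_J_J, inner_curvature_skew v u u w, neg_neg,
        inner_curvature_skew v (S.J x u) u (S.J x w), hS.curvature_J, S.inner_J_left, neg_neg]

theorem IsKahler.ricci_eq_sum (hS : S.IsKahler) {u : Fin n → TangentSpace 𝓘(ℝ, E) x}
    (hu : S.IsUnitaryFrame x u) (hE : finrank ℝ E = 2 * n) (v w : TangentSpace 𝓘(ℝ, E) x) :
    ricci x v w = ∑ i, inner ℝ (curvature x v (S.J x w) (u i)) (S.J x (u i)) := by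
  rw [ricci_eq_sum_inner_curvature (hu.orthonormalBasis hE)]
  simp only [hS.inner_curvature_J_J, hu.coe_orthonormalBasis, Fintype.sum_sum_type, Sum.elim_inl,
    Sum.elim_inr, Finset.sum_add_distrib]

end AlmostHermitianStructure

end Kahler

section ConnectionForm

namespace AlmostHermitianStructure

variable {E : Type*} [NormedAddCommGroup E] [NormedSpace ℝ E]
  {M : Type*} [TopologicalSpace M] [ChartedSpace E M] [IsManifold 𝓘(ℝ, E) ∞ M]
  [RiemannianBundle (fun x : M ↦ TangentSpace 𝓘(ℝ, E) x)]
  {S : AlmostHermitianStructure E M} {W Z : Π x : M, TangentSpace 𝓘(ℝ, E) x} {x : M} {n : ℕ}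

theorem hermitian_eq_clm_add (y : M) (v w : TangentSpace 𝓘(ℝ, E) y) :
    S.hermitian y v w = Complex.ofRealCLM (inner ℝ v w)
      + (Complex.I • Complex.ofRealCLM) (inner ℝ v (S.J y w)) :=
  Complex.ext (by simp [hermitian]) (by simp [hermitian, kahlerForm])

variable [FiniteDimensional ℝ E]
  [IsContMDiffRiemannianBundle 𝓘(ℝ, E) ∞ E (fun x : M ↦ TangentSpace 𝓘(ℝ, E) x)]

variable (S) in
theorem mdifferentiableAt_hermitian (hW : MDiffAt (T% W) x) (hZ : MDiffAt (T% Z) x) :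
    MDifferentiableAt 𝓘(ℝ, E) 𝓘(ℝ, ℂ) (fun y ↦ S.hermitian y (W y) (Z y)) x := by
  simp only [hermitian_eq_clm_add]
  exact (Complex.ofRealCLM.mdifferentiableAt.comp x (mdiffAt_inner hW hZ)).add
    ((Complex.I • Complex.ofRealCLM).mdifferentiableAt.comp x (mdiffAt_inner hW (S.mdiffAt_J hZ)))

theorem IsKahler.mvfderiv_hermitian (hS : S.IsKahler) (hW : MDiffAt (T% W) x)
    (hZ : MDiffAt (T% Z) x) (v : TangentSpace 𝓘(ℝ, E) x) :
    mvfderiv 𝓘(ℝ, E) (fun y ↦ S.hermitian y (W y) (Z y)) x v =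
      S.hermitian x (leviCivita E M W x v) (Z x) + S.hermitian x (W x) (leviCivita E M Z x v) := by
  have hJZ := S.mdiffAt_J hZ
  have hre := Complex.ofRealCLM.mdifferentiableAt.comp x (mdiffAt_inner hW hZ)
  have him := (Complex.I • Complex.ofRealCLM).mdifferentiableAt.comp x (mdiffAt_inner hW hJZ)
  simp only [Function.comp_def] at hre him
  simp only [hermitian_eq_clm_add]
  rw [mvfderiv_fun_add hre him, add_apply, mvfderiv_clm_comp _ (mdiffAt_inner hW hZ),
    mvfderiv_clm_comp _ (mdiffAt_inner hW hJZ), mvfderiv_inner hW hZ, mvfderiv_inner hW hJZ,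
    hS.leviCivita_J hZ, map_add, map_add]
  abel

variable {U : Fin n → Π y : M, TangentSpace 𝓘(ℝ, E) y}

variable (S) in
/-- A tuple of vector fields that are differentiable at `x` and form a unitary frame at every point
near `x`. -/
structure IsLocalUnitaryFrame (x : M) (U : Fin n → Π y : M, TangentSpace 𝓘(ℝ, E) y) : Prop where
  mdiffAt (i : Fin n) : MDiffAt (T% (U i)) x
  isUnitaryFrame : ∀ᶠ y in 𝓝 x, S.IsUnitaryFrame y fun i ↦ U i y

theorem IsKahler.hermitian_leviCivita_skew (hS : S.IsKahler)
    (hU : S.IsLocalUnitaryFrame x U) (v : TangentSpace 𝓘(ℝ, E) x) (i j : Fin n) :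
    S.hermitian x (leviCivita E M (U i) x v) (U j x) =
      -S.hermitian x (U i x) (leviCivita E M (U j) x v) := by
  have hconst : (fun y ↦ S.hermitian y (U i y) (U j y)) =ᶠ[𝓝 x] fun _ ↦ if i = j then 1 else 0 :=
    hU.isUnitaryFrame.mono fun y hy ↦ hy i j
  rw [← add_eq_zero_iff_eq_neg, ← hS.mvfderiv_hermitian (hU.mdiffAt i) (hU.mdiffAt j),
    mvfderiv_congr_of_eventuallyEq hconst, mvfderiv_const, zero_apply]

/-- The connection form of the canonical bundle in the local unitary frame `U`: up to the factor
`-i`, the trace of the matrix of one-forms `herm(∇ U_i, U_j)`. -/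
def connectionForm (S : AlmostHermitianStructure E M) (U : Fin n → Π y : M, TangentSpace 𝓘(ℝ, E) y)
    (x : M) (v : TangentSpace 𝓘(ℝ, E) x) : ℝ :=
  ∑ i, inner ℝ (leviCivita E M (U i) x v) (S.J x (U i x))

theorem IsKahler.sum_hermitian_leviCivita (hS : S.IsKahler) (hU : S.IsLocalUnitaryFrame x U)
    (v : TangentSpace 𝓘(ℝ, E) x) :
    ∑ i, S.hermitian x (U i x) (leviCivita E M (U i) x v) =
      -(Complex.I * S.connectionForm U x v) := by
  have hre (i : Fin n) : (S.hermitian x (U i x) (leviCivita E M (U i) x v)).re = 0 := by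
    have h := congrArg Complex.re (hS.hermitian_leviCivita_skew hU v i i)
    rw [← S.conj_hermitian, Complex.conj_re, Complex.neg_re] at h
    linarith
  have him (i : Fin n) : (S.hermitian x (U i x) (leviCivita E M (U i) x v)).im =
      -inner ℝ (leviCivita E M (U i) x v) (S.J x (U i x)) := by
    rw [real_inner_comm, S.inner_J_left, neg_neg]
    rfl
  refine Complex.ext ?_ ?_ <;> simp [hre, him, connectionForm]

end AlmostHermitianStructure

end ConnectionForm

section SpecialUnitaryFrames

theorem diagonal_update_one_mem_unitaryGroup {ι : Type*} [Fintype ι] [DecidableEq ι] (i : ι) {c : ℂ}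
    (hc : Complex.normSq c = 1) :
    Matrix.diagonal (Function.update 1 i c) ∈ Matrix.unitaryGroup ι ℂ := by
  rw [Matrix.mem_unitaryGroup_iff, Matrix.star_eq_conjTranspose, Matrix.diagonal_conjTranspose,
    Matrix.diagonal_mul_diagonal, ← Matrix.diagonal_one]
  congr with j
  rcases eq_or_ne j i with rfl | hj
  · simp [Complex.mul_conj, hc]
  · simp [hj]

open AlmostHermitianStructure

variable {E : Type*} [NormedAddCommGroup E] [NormedSpace ℝ E]
  {M : Type*} [TopologicalSpace M] [ChartedSpace E M] [IsManifold 𝓘(ℝ, E) ∞ M]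
  [RiemannianBundle (fun x : M ↦ TangentSpace 𝓘(ℝ, E) x)]
  {n : ℕ} {S : SpecialAlmostHermitianStructure E M n} {x : M}
  {U : Fin n → Π y : M, TangentSpace 𝓘(ℝ, E) y}

namespace SpecialAlmostHermitianStructure

variable (S) in
/-- A local unitary frame on which the complex volume form takes the value `1`. -/
structure IsLocalSpecialUnitaryFrame (x : M) (U : Fin n → Π y : M, TangentSpace 𝓘(ℝ, E) y) : Prop
    extends S.IsLocalUnitaryFrame x U where
  Ψ_eq_one : ∀ᶠ y in 𝓝 x, S.Ψ y (fun i ↦ U i y) = 1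

end SpecialAlmostHermitianStructure

namespace AlmostHermitianStructure

theorem IsUnitaryFrame.complexLinearCombination {S : AlmostHermitianStructure E M}
    {u : Fin n → TangentSpace 𝓘(ℝ, E) x} (hu : S.IsUnitaryFrame x u)
    {A : Matrix (Fin n) (Fin n) ℂ} (hA : A ∈ Matrix.unitaryGroup (Fin n) ℂ) :
    S.IsUnitaryFrame x fun i ↦ S.complexLinearCombination u (A i) := by
  intro i k
  have hdual (j : Fin n) :
      S.hermitian x (u j) (S.complexLinearCombination u (A k)) = star (A k j) := by
    rw [← S.conj_hermitian, S.hermitian_complexLinearCombination_left]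
    simp [hu _ _]
  rw [S.hermitian_complexLinearCombination_left]
  simp only [hdual]
  exact congrFun₂ (Matrix.mem_unitaryGroup_iff.1 hA) i k

theorem contMDiffAt_complexLinearCombination (S : AlmostHermitianStructure E M) {ι : Type*}
    [Fintype ι] {U : ι → Π y : M, TangentSpace 𝓘(ℝ, E) y} (hU : ∀ i, CMDiffAt ∞ (T% (U i)) x)
    {z : M → ι → ℂ} (hz : ∀ i, ContMDiffAt 𝓘(ℝ, E) 𝓘(ℝ, ℂ) ∞ (fun y ↦ z y i) x) :
    CMDiffAt ∞ (T% (fun y ↦ S.complexLinearCombination (fun i ↦ U i y) (z y))) x := by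
  simp only [complexLinearCombination_apply]
  have hclm (L : ℂ →L[ℝ] ℝ) (i : ι) : CMDiffAt ∞ (fun y ↦ L (z y i)) x :=
    L.contMDiff.contMDiffAt.comp x (hz i)
  exact ContMDiffAt.sum_section fun i _ ↦ ((hclm Complex.reCLM i).smul_section (hU i)).add_section
    ((hclm Complex.imCLM i).smul_section (S.contMDiffAt_J (hU i)))

end AlmostHermitianStructure

namespace SpecialAlmostHermitianStructure

variable (S) in
theorem normSq_Ψ {u : Fin n → TangentSpace 𝓘(ℝ, E) x} (hu : S.IsUnitaryFrame x u) :
    Complex.normSq (S.Ψ x u) = 1 := by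
  exact_mod_cast (formHermitian_self (S.Ψ x) u).symm.trans (S.Ψ_norm x u hu)

variable (S x) in
theorem exists_isLocalSpecialUnitaryFrame [NeZero n] [FiniteDimensional ℝ E]
    [IsContMDiffRiemannianBundle 𝓘(ℝ, E) ∞ E (fun x : M ↦ TangentSpace 𝓘(ℝ, E) x)]
    (hE : finrank ℝ E = 2 * n) :
    ∃ U : Fin n → Π y : M, TangentSpace 𝓘(ℝ, E) y, (∀ i, CMDiffAt ∞ (T% (U i)) x) ∧
      ∀ᶠ y in 𝓝 x, S.IsLocalSpecialUnitaryFrame y U := by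
  obtain ⟨U, hU, hunitary⟩ := S.exists_contMDiffAt_isUnitaryFrame x n hE.ge
  let d (y : M) : Fin n → ℂ := Function.update 1 0 (starRingEnd ℂ (S.Ψ y fun i ↦ U i y))
  have hd (i : Fin n) : ContMDiffAt 𝓘(ℝ, E) 𝓘(ℝ, ℂ) ∞ (fun y ↦ d y i) x := by
    rcases eq_or_ne i 0 with rfl | hi
    · simpa [d, Function.comp_def] using
        Complex.conjCLE.toContinuousLinearMap.contMDiff.contMDiffAt.comp x (S.contMDiffAt_Ψ x U hU)
    · simpa [d, hi] using contMDiffAt_const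
  let V (i : Fin n) (y : M) : TangentSpace 𝓘(ℝ, E) y :=
    S.complexLinearCombination (fun j ↦ U j y) (Matrix.diagonal (d y) i)
  have hV (i : Fin n) : CMDiffAt ∞ (T% (V i)) x := by
    refine S.contMDiffAt_complexLinearCombination hU fun j ↦ ?_
    rcases eq_or_ne i j with rfl | hij
    · simpa using hd i
    · simpa [hij] using contMDiffAt_const
  have hVspecial : ∀ᶠ y in 𝓝 x,
      S.IsUnitaryFrame y (fun i ↦ V i y) ∧ S.Ψ y (fun i ↦ V i y) = 1 := by
    filter_upwards [hunitary] with y hy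
    have hΨ := S.normSq_Ψ hy
    refine ⟨hy.complexLinearCombination
      (diagonal_update_one_mem_unitaryGroup 0 ((Complex.normSq_conj _).trans hΨ)), ?_⟩
    rw [map_complexLinearCombination_eq_det_mul (S.Ψ_J y), Matrix.det_diagonal]
    simp [d, Finset.prod_update_of_mem, ← Complex.normSq_eq_conj_mul_self, hΨ]
  refine ⟨V, hV, ?_⟩
  filter_upwards [Filter.eventually_all.2 fun i ↦ eventually_mdifferentiableAt (hV i),
    hVspecial.eventually_nhds] with y hVy hy
  exact ⟨⟨hVy, hy.mono fun _ ↦ And.left⟩, hy.mono fun _ ↦ And.right⟩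

end SpecialAlmostHermitianStructure

end SpecialUnitaryFrames

section Endomorphisms

variable {E : Type*} [NormedAddCommGroup E] [NormedSpace ℝ E]
  {M : Type*} [TopologicalSpace M] [ChartedSpace E M] {x : M} {n : ℕ}

theorem endAction_sub (A B : TangentSpace 𝓘(ℝ, E) x →L[ℝ] TangentSpace 𝓘(ℝ, E) x)
    (a : TangentSpace 𝓘(ℝ, E) x [⋀^Fin n]→ₗ[ℝ] ℂ) (w : Fin n → TangentSpace 𝓘(ℝ, E) x) :
    endAction (A - B) a w = endAction A a w - endAction B a w := by
  simp only [endAction, sub_apply, a.map_update_sub, Finset.sum_sub_distrib]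
  ring

variable [FiniteDimensional ℝ E] [RiemannianBundle (fun x : M ↦ TangentSpace 𝓘(ℝ, E) x)]
  (A A' B : TangentSpace 𝓘(ℝ, E) x →L[ℝ] TangentSpace 𝓘(ℝ, E) x)

theorem endInner_sub_left : endInner (A - A') B = endInner A B - endInner A' B := by
  simp [endInner, inner_sub_left]

theorem endInner_smul_left (c : ℝ) : endInner (c • A) B = c * endInner A B := by
  simp [endInner, real_inner_smul_left, Finset.mul_sum]

theorem trace_adjoint_comp_eq_sum {ι : Type*} [Fintype ι]
    (e : OrthonormalBasis ι ℝ (TangentSpace 𝓘(ℝ, E) x)) :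
    haveI : FiniteDimensional ℝ (TangentSpace 𝓘(ℝ, E) x) := inferInstanceAs (FiniteDimensional ℝ E)
    LinearMap.trace ℝ (TangentSpace 𝓘(ℝ, E) x) (A.toLinearMap.adjoint ∘ₗ B.toLinearMap) =
      ∑ i, inner ℝ (A (e i)) (B (e i)) := by
  rw [LinearMap.trace_eq_sum_inner _ e]
  simp [LinearMap.adjoint_inner_right]

theorem endInner_eq_sum {ι : Type*} [Fintype ι]
    (e : OrthonormalBasis ι ℝ (TangentSpace 𝓘(ℝ, E) x)) :
    endInner A B = ∑ i, inner ℝ (A (e i)) (B (e i)) := by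
  rw [endInner, ← trace_adjoint_comp_eq_sum, trace_adjoint_comp_eq_sum A B e]

variable {A} in
theorem endInner_self_eq_zero : endInner A A = 0 ↔ A = 0 := by
  constructor
  · intro h
    rw [endInner, Finset.sum_eq_zero_iff_of_nonneg fun _ _ ↦ real_inner_self_nonneg] at h
    refine ContinuousLinearMap.coe_injective <|
      (stdOrthonormalBasis ℝ (TangentSpace 𝓘(ℝ, E) x)).toBasis.ext fun i ↦ ?_
    simpa using h i (Finset.mem_univ i)
  · rintro rfl
    simp [endInner]

variable [IsManifold 𝓘(ℝ, E) ∞ M] {S : AlmostHermitianStructure E M}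
  {u : Fin n → TangentSpace 𝓘(ℝ, E) x}

theorem AlmostHermitianStructure.IsUnitaryFrame.endInner_J (hu : S.IsUnitaryFrame x u)
    (hE : finrank ℝ E = 2 * n) (hB : ∀ w, B (S.J x w) = S.J x (B w)) :
    endInner (S.J x) B = 2 * (∑ j, S.hermitian x (B (u j)) (u j)).im := by
  rw [endInner_eq_sum _ _ (hu.orthonormalBasis hE)]
  simp only [hu.coe_orthonormalBasis, Fintype.sum_sum_type, Sum.elim_inl, Sum.elim_inr, hB,
    S.inner_J_J, ← two_mul, real_inner_comm (B _), Complex.im_sum]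
  rfl

end Endomorphisms

section EtaHat

variable {E : Type*} [NormedAddCommGroup E] [NormedSpace ℝ E] [FiniteDimensional ℝ E]
  {M : Type*} [TopologicalSpace M] [ChartedSpace E M] [IsManifold 𝓘(ℝ, E) ∞ M]
  [RiemannianBundle (fun x : M ↦ TangentSpace 𝓘(ℝ, E) x)]
  {n : ℕ} {S : SpecialAlmostHermitianStructure E M n} {x : M}
  {U : Fin n → Π y : M, TangentSpace 𝓘(ℝ, E) y} {v : TangentSpace 𝓘(ℝ, E) x}
  {A B : TangentSpace 𝓘(ℝ, E) x →L[ℝ] TangentSpace 𝓘(ℝ, E) x}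

namespace SpecialAlmostHermitianStructure

theorem sum_hermitian_eq_zero_of_isSU {u : Fin n → TangentSpace 𝓘(ℝ, E) x}
    (hu : S.IsUnitaryFrame x u) (hE : finrank ℝ E = 2 * n) (hB : S.IsSU x B) :
    ∑ j, S.hermitian x (B (u j)) (u j) = 0 := by
  have hΨ : S.Ψ x u ≠ 0 := Complex.normSq_eq_zero.not.1 (by rw [S.normSq_Ψ hu]; exact one_ne_zero)
  have h := hB.2.2 u
  rwa [hu.endAction_eq_neg_trace_mul hE (S.Ψ_J x) hB.2.1, mul_eq_zero, or_iff_left hΨ,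
    neg_eq_zero] at h

variable [IsContMDiffRiemannianBundle 𝓘(ℝ, E) ∞ E (fun x : M ↦ TangentSpace 𝓘(ℝ, E) x)]

theorem IsIntrinsicTorsionAt.unique (hA : S.IsIntrinsicTorsionAt x v A)
    (hB : S.IsIntrinsicTorsionAt x v B) : A = B := by
  obtain ⟨⟨hAskew, hAperp⟩, hAJ, hAΨ⟩ := hA
  obtain ⟨⟨hBskew, hBperp⟩, hBJ, hBΨ⟩ := hB
  have hsu : S.IsSU x (A - B) := by
    refine ⟨fun u w ↦ ?_, fun w ↦ ?_, fun w ↦ ?_⟩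
    · simp only [sub_apply, inner_sub_left, inner_sub_right, hAskew u w, hBskew u w]
      ring
    · have h := (hAJ w).trans (hBJ w).symm
      rw [add_right_inj] at h
      rw [sub_apply, sub_apply, map_sub, sub_eq_sub_iff_sub_eq_sub, h]
    · rw [endAction_sub, sub_eq_zero]
      exact add_left_cancel ((hAΨ w).trans (hBΨ w).symm)
  rw [← sub_eq_zero, ← endInner_self_eq_zero, endInner_sub_left, hAperp _ hsu, hBperp _ hsu,
    sub_zero]

theorem IsIntrinsicTorsionAt.intrinsicTorsion_eq (hA : S.IsIntrinsicTorsionAt x v A) :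
    S.intrinsicTorsion x v = A :=
  IsIntrinsicTorsionAt.unique (Classical.epsilon_spec ⟨A, hA⟩) hA

theorem IsLocalSpecialUnitaryFrame.nablaΨ_eq (hU : S.IsLocalSpecialUnitaryFrame x U)
    (hS : S.IsKahler) (hE : finrank ℝ E = 2 * n) (v : TangentSpace 𝓘(ℝ, E) x)
    (w : Fin n → TangentSpace 𝓘(ℝ, E) x) :
    S.nablaΨ x v w = -(Complex.I * S.connectionForm U x v) * S.Ψ x w := by
  have hu := hU.isUnitaryFrame.self_of_nhds
  have hΨu := hU.Ψ_eq_one.self_of_nhds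
  have hw (i : Fin n) := mdifferentiableAt_extend 𝓘(ℝ, E) E (w i)
  let A (y : M) : Matrix (Fin n) (Fin n) ℂ := .of fun i j ↦ S.hermitian y (extend E (w i) y) (U j y)
  let Q : Matrix (Fin n) (Fin n) ℂ := .of fun i j ↦ S.hermitian x (U i x) (leviCivita E M (U j) x v)
  have Ψ_eq_det : (fun y ↦ S.Ψ y fun i ↦ extend E (w i) y) =ᶠ[𝓝 x] fun y ↦ (A y).det := by
    filter_upwards [hU.isUnitaryFrame, hU.Ψ_eq_one] with y hy hΨ
    rw [hy.map_eq_det_mul hE (S.Ψ_J y), hΨ, mul_one]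
  have Ψ_update_eq_det (i : Fin n) :
      S.Ψ x (Function.update w i (leviCivita E M (extend E (w i)) x v)) =
        ((A x).updateRow i fun j ↦
          S.hermitian x (leviCivita E M (extend E (w i)) x v) (U j x)).det := by
    rw [hu.map_update_eq_det_mul hE (S.Ψ_J x), hΨu, mul_one]
    simp only [A, extend_apply_self]
  have deriv_A (i : Fin n) : (fun j ↦ mvfderiv 𝓘(ℝ, E) (fun y ↦ A y i j) x v) =
      (fun j ↦ S.hermitian x (leviCivita E M (extend E (w i)) x v) (U j x)) + (A x * Q) i := by
    ext j
    refine (hS.mvfderiv_hermitian (hw i) (hU.mdiffAt j) v).trans (congrArg _ ?_)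
    rw [hu.hermitian_eq_sum hE]
    rfl
  rw [nablaΨ, mvfderiv_congr_of_eventuallyEq Ψ_eq_det,
    mvfderiv_det (A := A) fun i j ↦ S.mdifferentiableAt_hermitian (hw i) (hU.mdiffAt j)]
  simp only [deriv_A, Matrix.det_updateRow_add, Ψ_update_eq_det, Finset.sum_add_distrib,
    add_sub_cancel_left]
  have det_A : (A x).det = S.Ψ x w := by simpa using Ψ_eq_det.self_of_nhds.symm
  rw [sum_det_updateRow_mul, det_A, ← hS.sum_hermitian_leviCivita hU.toIsLocalUnitaryFrame]
  rfl

theorem isIntrinsicTorsionAt_smul_J [NeZero n] (hS : S.IsKahler) (hE : finrank ℝ E = 2 * n)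
    (hU : S.IsLocalSpecialUnitaryFrame x U) (v : TangentSpace 𝓘(ℝ, E) x) :
    S.IsIntrinsicTorsionAt x v ((-(n : ℝ)⁻¹ * S.connectionForm U x v) • S.J x) := by
  set c : ℝ := -(n : ℝ)⁻¹ * S.connectionForm U x v with hc
  have hu := hU.isUnitaryFrame.self_of_nhds
  have hJ (w : TangentSpace 𝓘(ℝ, E) x) : (c • S.J x) (S.J x w) = S.J x ((c • S.J x) w) := by simp
  refine ⟨⟨fun u w ↦ ?_, fun B hB ↦ ?_⟩, fun w ↦ ?_, fun w ↦ ?_⟩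
  · simp [real_inner_smul_left, real_inner_smul_right, S.inner_J_left]
  · rw [endInner_smul_left, hu.endInner_J _ hE hB.2.1, sum_hermitian_eq_zero_of_isSU hu hE hB,
      Complex.zero_im, mul_zero, mul_zero]
  · rw [hS x v w, hJ, sub_self, add_zero]
  · rw [hU.nablaΨ_eq hS hE, hu.endAction_eq_neg_trace_mul hE (S.Ψ_J x) hJ]
    have hn : (n : ℂ) ≠ 0 := Nat.cast_ne_zero.2 (NeZero.ne n)
    have trace_eq : ∑ j, S.hermitian x ((c • S.J x) (U j x)) (U j x) = n * c * Complex.I := by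
      simp [S.hermitian_smul_left, S.hermitian_J_left, hu _ _, mul_assoc]
    rw [trace_eq, hc]
    push_cast
    field_simp
    ring

theorem etaHat_eq [NeZero n] (hS : S.IsKahler) (hE : finrank ℝ E = 2 * n)
    (hU : S.IsLocalSpecialUnitaryFrame x U) (v : TangentSpace 𝓘(ℝ, E) x) :
    S.etaHat x v = -(n : ℝ)⁻¹ * S.connectionForm U x v := by
  have hJJ : endInner (S.J x) (S.J x) = 2 * n := by
    have hu := hU.isUnitaryFrame.self_of_nhds
    rw [hu.endInner_J _ hE fun _ ↦ rfl]
    simp [S.hermitian_J_left, hu _ _]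
  rw [etaHat, (isIntrinsicTorsionAt_smul_J hS hE hU v).intrinsicTorsion_eq, endInner_smul_left,
    mul_div_cancel_right₀ _ (by rw [hJJ]; exact_mod_cast mul_ne_zero two_ne_zero (NeZero.ne n))]

end SpecialAlmostHermitianStructure

end EtaHat

section OneFormDeriv

variable {E : Type*} [NormedAddCommGroup E] [NormedSpace ℝ E]
  {M : Type*} [TopologicalSpace M] [ChartedSpace E M] [IsManifold 𝓘(ℝ, E) ∞ M]
  {θ θ' : Π x : M, TangentSpace 𝓘(ℝ, E) x → ℝ} {x : M}

theorem oneFormDeriv_congr (h : ∀ᶠ y in 𝓝 x, ∀ v, θ y v = θ' y v) (v w : TangentSpace 𝓘(ℝ, E) x) :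
    oneFormDeriv θ x v w = oneFormDeriv θ' x v w := by
  have deriv_eq (u : TangentSpace 𝓘(ℝ, E) x) :
      d% (fun y ↦ θ y (extend E u y)) x = d% (fun y ↦ θ' y (extend E u y)) x :=
    mvfderiv_congr_of_eventuallyEq (h.mono fun y hy ↦ hy _)
  rw [oneFormDeriv, oneFormDeriv, deriv_eq, deriv_eq, h.self_of_nhds]

theorem oneFormDeriv_const_mul
    (hθ : ∀ u : TangentSpace 𝓘(ℝ, E) x, MDiffAt (fun y ↦ θ y (extend E u y)) x) (c : ℝ)
    (v w : TangentSpace 𝓘(ℝ, E) x) :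
    oneFormDeriv (fun y u ↦ c * θ y u) x v w = c * oneFormDeriv θ x v w := by
  have deriv_eq (u z : TangentSpace 𝓘(ℝ, E) x) :
      d% (fun y ↦ c * θ y (extend E u y)) x z = c * d% (fun y ↦ θ y (extend E u y)) x z :=
    mvfderiv_clm_comp (c • ContinuousLinearMap.id ℝ ℝ) (hθ u) z
  rw [oneFormDeriv, oneFormDeriv, deriv_eq, deriv_eq]
  ring

end OneFormDeriv

section RicciForm

variable {E : Type*} [NormedAddCommGroup E] [NormedSpace ℝ E] [FiniteDimensional ℝ E]
  {M : Type*} [TopologicalSpace M] [ChartedSpace E M] [IsManifold 𝓘(ℝ, E) ∞ M]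
  [RiemannianBundle (fun x : M ↦ TangentSpace 𝓘(ℝ, E) x)]
  [IsContMDiffRiemannianBundle 𝓘(ℝ, E) ∞ E (fun x : M ↦ TangentSpace 𝓘(ℝ, E) x)] {n : ℕ} {x : M}

namespace AlmostHermitianStructure

variable {S : AlmostHermitianStructure E M} {U : Fin n → Π y : M, TangentSpace 𝓘(ℝ, E) y}

theorem IsKahler.sum_inner_leviCivita_J (hS : S.IsKahler) (hE : finrank ℝ E = 2 * n)
    (hU : S.IsLocalUnitaryFrame x U) (v w : TangentSpace 𝓘(ℝ, E) x) :
    ∑ i, inner ℝ (leviCivita E M (U i) x v) (S.J x (leviCivita E M (U i) x w)) = 0 := by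
  have conj_eq : starRingEnd ℂ (∑ i, S.hermitian x (leviCivita E M (U i) x v)
        (leviCivita E M (U i) x w)) =
      ∑ i, S.hermitian x (leviCivita E M (U i) x v) (leviCivita E M (U i) x w) := by
    have parseval (i : Fin n) := hU.isUnitaryFrame.self_of_nhds.hermitian_eq_sum hE
      (leviCivita E M (U i) x v) (leviCivita E M (U i) x w)
    simp only [parseval, map_sum, map_mul, S.conj_hermitian]
    rw [Finset.sum_comm]
    refine Finset.sum_congr rfl fun i _ ↦ Finset.sum_congr rfl fun j _ ↦ ?_
    rw [hS.hermitian_leviCivita_skew hU v i j, hS.hermitian_leviCivita_skew hU w j i, neg_mul,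
      mul_neg]
  exact (Complex.im_sum _ _).symm.trans (Complex.conj_eq_iff_im.1 conj_eq)

theorem contMDiffAt_connectionForm {X : Π y : M, TangentSpace 𝓘(ℝ, E) y}
    (hU : ∀ i, CMDiffAt ∞ (T% (U i)) x) (hX : CMDiffAt ∞ (T% X) x) :
    CMDiffAt ∞ (fun y ↦ S.connectionForm U y (X y)) x :=
  contMDiffAt_finsetSum fun i _ ↦
    contMDiffAt_inner (contMDiffAt_leviCivita hX (hU i)) (S.contMDiffAt_J (hU i))

theorem IsKahler.mvfderiv_connectionForm (hS : S.IsKahler) (hE : finrank ℝ E = 2 * n)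
    (hU : ∀ i, CMDiffAt ∞ (T% (U i)) x) (hunitary : ∀ᶠ y in 𝓝 x, S.IsUnitaryFrame y (U · y))
    {X : Π y : M, TangentSpace 𝓘(ℝ, E) y} (hX : CMDiffAt ∞ (T% X) x) (v : TangentSpace 𝓘(ℝ, E) x) :
    d% (fun y ↦ S.connectionForm U y (X y)) x v =
      ∑ i, inner ℝ (leviCivita E M (fun y ↦ leviCivita E M (U i) y (X y)) x v)
        (S.J x (U i x)) := by
  have hUdiff (i : Fin n) : MDiffAt (T% (U i)) x := (hU i).mdifferentiableAt (by simp)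
  have hframe : S.IsLocalUnitaryFrame x U := ⟨hUdiff, hunitary⟩
  have hdU (i : Fin n) := mdiffAt_leviCivita hX (hU i)
  have hJU (i : Fin n) := S.mdiffAt_J (hUdiff i)
  simp only [connectionForm]
  rw [mvfderiv_finsetSum_apply fun i ↦ mdiffAt_inner (hdU i) (hJU i)]
  simp only [mvfderiv_inner (hdU _) (hJU _), hS.leviCivita_J (hUdiff _), Finset.sum_add_distrib,
    hS.sum_inner_leviCivita_J hE hframe, add_zero]

theorem IsKahler.oneFormDeriv_connectionForm (hS : S.IsKahler) (hE : finrank ℝ E = 2 * n)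
    (hU : ∀ i, CMDiffAt ∞ (T% (U i)) x) (hunitary : ∀ᶠ y in 𝓝 x, S.IsUnitaryFrame y (U · y))
    (v w : TangentSpace 𝓘(ℝ, E) x) :
    oneFormDeriv (S.connectionForm U) x v w =
      -∑ i, inner ℝ (curvature x v w (U i x)) (S.J x (U i x)) := by
  have hv : CMDiffAt ∞ (T% (extend E v)) x := contMDiffAt_extend 𝓘(ℝ, E) E v
  have hw : CMDiffAt ∞ (T% (extend E w)) x := contMDiffAt_extend 𝓘(ℝ, E) E w
  have curvature_eq (i : Fin n) : curvature x v w (U i x) =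
      curvatureField (extend E v) (extend E w) (U i) x :=
    curvatureField_congr_right hv hw (contMDiffAt_extend 𝓘(ℝ, E) E (U i x)) (hU i) (by simp)
  rw [oneFormDeriv, hS.mvfderiv_connectionForm hE hU hunitary hw,
    hS.mvfderiv_connectionForm hE hU hunitary hv]
  simp only [curvature_eq, curvatureField, connectionForm, inner_sub_left, Finset.sum_sub_distrib,
    extend_apply_self]
  ring

end AlmostHermitianStructure

end RicciForm

open AlmostHermitianStructure SpecialAlmostHermitianStructure in
theorem theorem3p4_general {n : ℕ} [NeZero n]
    {E : Type*} [NormedAddCommGroup E] [NormedSpace ℝ E] [FiniteDimensional ℝ E]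
    (hE : Module.finrank ℝ E = 2 * n)
    {M : Type*} [TopologicalSpace M] [ChartedSpace E M] [IsManifold 𝓘(ℝ, E) ∞ M]
    [RiemannianBundle (fun x : M ↦ TangentSpace 𝓘(ℝ, E) x)]
    [IsContMDiffRiemannianBundle 𝓘(ℝ, E) ∞ E (fun x : M ↦ TangentSpace 𝓘(ℝ, E) x)]
    (S : SpecialAlmostHermitianStructure E M n) (hS : S.IsKahler) :
    (∀ (x : M) (v w : TangentSpace 𝓘(ℝ, E) x), S.starRicci x v w = ricci x v w) ∧
    ∀ (x : M) (v w : TangentSpace 𝓘(ℝ, E) x),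
      ricci x v w = n * oneFormDeriv S.etaHat x v (S.J x w) := by
  refine ⟨fun x ↦ hS.starRicci_eq_ricci, fun x v w ↦ ?_⟩
  obtain ⟨U, hU, hframe⟩ := S.exists_isLocalSpecialUnitaryFrame x hE
  have hx := hframe.self_of_nhds
  have eventually_etaHat_eq :
      ∀ᶠ y in 𝓝 x, ∀ u, S.etaHat y u = -(n : ℝ)⁻¹ * S.connectionForm U y u :=
    hframe.mono fun y hy ↦ etaHat_eq hS hE hy
  rw [oneFormDeriv_congr eventually_etaHat_eq,
    oneFormDeriv_const_mul fun u ↦ (contMDiffAt_connectionForm hU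
      (contMDiffAt_extend 𝓘(ℝ, E) E u)).mdifferentiableAt (by simp),
    hS.oneFormDeriv_connectionForm hE hU hx.isUnitaryFrame,
    hS.ricci_eq_sum hx.isUnitaryFrame.self_of_nhds hE, neg_mul_neg,
    mul_inv_cancel_left₀ (Nat.cast_ne_zero.2 (NeZero.ne n))]

end

theorem theorem3p4 {n : ℕ} (hn : 2 ≤ n)
    {E : Type*} [NormedAddCommGroup E] [NormedSpace ℝ E] [FiniteDimensional ℝ E]
    (hE : Module.finrank ℝ E = 2 * n)
    {M : Type*} [TopologicalSpace M] [T2Space M] [SecondCountableTopology M]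
    [ChartedSpace E M] [IsManifold 𝓘(ℝ, E) ∞ M]
    [RiemannianBundle (fun x : M ↦ TangentSpace 𝓘(ℝ, E) x)]
    [IsContMDiffRiemannianBundle 𝓘(ℝ, E) ∞ E (fun x : M ↦ TangentSpace 𝓘(ℝ, E) x)]
    (S : SpecialAlmostHermitianStructure E M n) (hS : S.IsKahler) :
    (∀ (x : M) (v w : TangentSpace 𝓘(ℝ, E) x), S.starRicci x v w = ricci x v w) ∧
    (∀ c : ℝ, c ≠ 0 →
      (∀ (x : M) (v w : TangentSpace 𝓘(ℝ, E) x),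
        oneFormDeriv S.etaHat x v w = c * S.kahlerForm x v w) → IsEinstein E M) ∧
    ((∀ (x : M) (v w : TangentSpace 𝓘(ℝ, E) x), oneFormDeriv S.etaHat x v w = 0) →
      IsRicciFlat E M) := by
  have : NeZero n := ⟨by omega⟩
  obtain ⟨hstar, hricci⟩ := theorem3p4_general hE S hS
  refine ⟨hstar, fun c _ hη ↦ ⟨-(n * c), fun x v w ↦ ?_⟩, fun hη x v w ↦ by simp [hricci, hη]⟩
  rw [hricci, hη, AlmostHermitianStructure.kahlerForm, S.J_J, inner_neg_right]
  ring
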